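/- Let $d>1$ be an odd integer, let $0\le r_0<r_1\le\infty$, and put $A(r_0,r_1)=\{x\in\mathbb R^d : r_0<|x|<r_1\}$. Throughout, $1/0$ is read as $\infty$. Let $0\le\tau<\frac1{2r_0}$ and let $f:A(r_0,r_1)\to\mathbb C$ be polyharmonic of infinite order and type $\tau$; that is, $f$ is $C^\infty$ and for every compact $K\subset A(r_0,r_1)$ and every $\varepsilon>0$ there is a constant $C_{K,\varepsilon}>0$ such that $$\max_{x\in K}|\Delta^pf(x)|\le C_{K,\varepsilon}\,(2p)!\,(\tau+\varepsilon)^{2p}\qquad\text{for all } p\in\mathbb N_0,$$ where $\Delta$ is the Laplace operator. For $k\in\mathbb N_0$ let $Y_{k,1},\dots,Y_{k,a_k}$ be a basis of the ($a_k$-dimensional, complex) space of harmonic homogeneous polynomials of degree $k$ in $d$ variables, orthonormal with respect to $\langle g,h\rangle=\int_{\mathbb S^{d-1}}g(\theta)\overline{h(\theta)}\,d\theta$, where $d\theta$ is the surface measure on the unit sphere. For $l\in\{1,\dots,a_k\}$ let $$f_{k,l}(r)=\int_{\mathbb S^{d-1}}f(r\theta)\overline{Y_{k,l}(\theta)}\,d\theta\quad(r_0<r<r_1),\qquad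 \widetilde f_{k,l}(v)=f_{k,l}(e^v).$$ For $j\in\mathbb N_0$ put $\lambda_{2j}=k+2j$ and $\lambda_{2j+1}=-k-d+2+2j$, and for $n\in\mathbb N_0$ put $$D^{(n)}g=\Bigl(\frac{d}{dv}-\lambda_0\Bigr)\cdots\Bigl(\frac{d}{dv}-\lambda_{n-1}\Bigr)g,\qquad q_n(\lambda)=\prod_{j=0}^n(\lambda-\lambda_j),$$ with $D^{(0)}g=g$. Then for all $k\in\mathbb N_0$, all $l\in\{1,\dots,a_k\}$ and every real $v_0$ with $r_0<e^{v_0}<\min\{r_1,\frac1{2\tau}\}$, the double series $$F_{k,l}(z)=\sum_{n=0}^\infty\sum_{j=0}^nD^{(n)}\widetilde f_{k,l}(v_0)\,\frac{e^{-\lambda_jv_0}}{q_n'(\lambda_j)}\,z^{\lambda_j}$$ converges absolutely and compactly in $\{z\in\mathbb C : 0<|z|<\frac1{2\tau}\}$ (the double series and the double series of the absolute values of its terms converge uniformly on every compact subset), and $$F_{k,l}(r)=f_{k,l}(r)\qquad\text{for all } r\in\Bigl(r_0,\min\bigl\{r_1,\tfrac1{2\tau}\bigr\}\Bigr).$$ 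-/

import Mathlib

open scoped NNReal ENNReal Nat ContDiff Laplacian

noncomputable section

namespace Polyharmonic

/-- The annular region `A(r₀, r₁) = {x ∈ ℝ^d ; r₀ < |x| < r₁}`, with `0 ≤ r₀` and `r₁ ≤ ∞`. -/
def annularRegion (d : ℕ) (r₀ : ℝ≥0) (r₁ : ℝ≥0∞) : Set (EuclideanSpace ℝ (Fin d)) :=
  {x | (r₀ : ℝ≥0∞) < ‖x‖ₑ ∧ ‖x‖ₑ < r₁}

/-- `f` is polyharmonic of infinite order and type `τ` on the open set `G`: it is smooth on `G`
(so that all iterated Laplacians exist there), and for all compact `K ⊆ G` and `ε > 0` there is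
`C > 0` such that `|Δ^p f| ≤ C (2p)! (τ + ε)^{2p}` on `K` for all `p`.
The values of `f` outside `G` are irrelevant, since `G` is open. -/
def IsPolyharmonicInfiniteOrder {d : ℕ} (f : EuclideanSpace ℝ (Fin d) → ℂ) (τ : ℝ≥0)
    (G : Set (EuclideanSpace ℝ (Fin d))) : Prop :=
  ContDiffOn ℝ ∞ f G ∧
    ∀ K ⊆ G, IsCompact K → ∀ ε : ℝ, 0 < ε → ∃ C : ℝ, 0 < C ∧ ∀ p : ℕ, ∀ x ∈ K,
      ‖(Laplacian.laplacian^[p] f) x‖ ≤ C * ((2 * p)! : ℝ) * ((τ : ℝ) + ε) ^ (2 * p)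

/-- The complex linear space of harmonic homogeneous polynomials of degree `k` in `d` variables. -/
def harmonicHomogeneous (d k : ℕ) : Submodule ℂ (MvPolynomial (Fin d) ℂ) :=
  MvPolynomial.homogeneousSubmodule (Fin d) ℂ k ⊓
    LinearMap.ker (∑ i : Fin d,
      (MvPolynomial.pderiv i : Derivation ℂ _ _).toLinearMap ∘ₗ
        (MvPolynomial.pderiv i : Derivation ℂ (MvPolynomial (Fin d) ℂ) _).toLinearMap)

/-- `a_k`, the dimension of the space of harmonic homogeneous polynomials of degree `k`. -/
def harmonicDim (d k : ℕ) : ℕ := Module.finrank ℂ (harmonicHomogeneous d k)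

/-- The value of a polynomial with complex coefficients at a point of `ℝ^d`. -/
def evalReal {d : ℕ} (P : MvPolynomial (Fin d) ℂ) (x : EuclideanSpace ℝ (Fin d)) : ℂ :=
  MvPolynomial.eval (fun i => ((x i : ℝ) : ℂ)) P

/-- The surface measure `dθ` on the unit sphere of `ℝ^d`. -/
def surfaceMeasure (d : ℕ) :
    MeasureTheory.Measure (Metric.sphere (0 : EuclideanSpace ℝ (Fin d)) 1) :=
  (MeasureTheory.volume : MeasureTheory.Measure (EuclideanSpace ℝ (Fin d))).toSphere

/-- `Y_1, …, Y_{a_k}` is a basis of the space of harmonic homogeneous polynomials of degree `k`,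
orthonormal for `⟨f, g⟩ = ∫ f(θ) conj(g(θ)) dθ` on the unit sphere
(linear independence follows from orthonormality). -/
def IsOrthonormalHarmonicBasis (d k : ℕ)
    (Y : Fin (harmonicDim d k) → MvPolynomial (Fin d) ℂ) : Prop :=
  Submodule.span ℂ (Set.range Y) = harmonicHomogeneous d k ∧
    ∀ l m, ∫ θ, evalReal (Y l) θ * (starRingEnd ℂ) (evalReal (Y m) θ) ∂(surfaceMeasure d) =
      if l = m then 1 else 0

/-- The Fourier-Laplace coefficient `r ↦ ∫ f(rθ) conj(Y(θ)) dθ`. -/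
def fourierLaplaceCoeff {d : ℕ} (f : EuclideanSpace ℝ (Fin d) → ℂ)
    (Y : MvPolynomial (Fin d) ℂ) (r : ℝ) : ℂ :=
  ∫ θ : Metric.sphere (0 : EuclideanSpace ℝ (Fin d)) 1,
    f (r • (θ : EuclideanSpace ℝ (Fin d))) * (starRingEnd ℂ) (evalReal Y θ) ∂(surfaceMeasure d)

/-- The exponents `λ_{2j}(k) = k + 2j` and `λ_{2j+1}(k) = -k - d + 2 + 2j`. -/
def exponent (d k n : ℕ) : ℤ :=
  if Even n then (k : ℤ) + 2 * ((n / 2 : ℕ) : ℤ)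
  else -(k : ℤ) - (d : ℤ) + 2 + 2 * ((n / 2 : ℕ) : ℤ)

/-- `D^{(n)} g = (d/dv - λ_0) ⋯ (d/dv - λ_{n-1}) g`; the factors commute on smooth functions, and
`D^{(n+1)} g = (d/dv - λ_n) D^{(n)} g`. -/
def genDeriv (d k : ℕ) : ℕ → (ℝ → ℂ) → ℝ → ℂ
  | 0, g => g
  | n + 1, g => fun v => deriv (genDeriv d k n g) v - (exponent d k n : ℂ) * genDeriv d k n g v

/-- `q_n(λ) = ∏_{j=0}^n (λ - λ_j(k))`. -/
def symbolPoly (d k n : ℕ) : Polynomial ℂ :=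
  ∏ j ∈ Finset.range (n + 1), (Polynomial.X - Polynomial.C (exponent d k j : ℂ))

/-- The term `D^{(n)} f̃(v₀) · e^{-λ_j(k) v₀} / q_n'(λ_j(k)) · z^{λ_j(k)}` of the double series, where
`f̃(v) = g(e^v)`. -/
def seriesTerm (d k : ℕ) (g : ℝ → ℂ) (v₀ : ℝ) (n j : ℕ) (z : ℂ) : ℂ :=
  genDeriv d k n (fun v => g (Real.exp v)) v₀ *
    (Complex.exp (-(exponent d k j : ℂ) * (v₀ : ℂ)) /
      (Polynomial.derivative (symbolPoly d k n)).eval (exponent d k j : ℂ)) *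
    z ^ exponent d k j

/-- The sum `∑_{n=0}^∞ ∑_{j=0}^n` of the double series. -/
def seriesSum (d k : ℕ) (g : ℝ → ℂ) (v₀ : ℝ) (z : ℂ) : ℂ :=
  ∑' n : ℕ, ∑ j ∈ Finset.range (n + 1), seriesTerm d k g v₀ n j z

end Polyharmonic

end

/-!
Write `f̃ = f_{k,l} ∘ exp`. The surface measure is rotation invariant, so the angular part of `Δ`
acts on Fourier-Laplace coefficients of degree `k` as multiplication by `-k(k+d-2)`, and `|x|²Δ`
acts on them as `(d/dv)² + (d-2) d/dv - k(k+d-2)`. This operator has the characteristic roots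
`λ_0` and `λ_1`, and iteration gives `D^{(2p)} f̃ = e^{2pv} (Δ^p f)_{k,l}(e^v)`: the hypothesis on
`f` bounds the derivatives `D^{(2p)} f̃` by `(2p)! (σ e^v)^{2p}` for every `σ > τ`, and Landau's
inequality then takes care of the odd orders.

The inner sums are the terms `D^{(n)} f̃(v₀) Φ_n(v - v₀)`, `z = e^v`, of Taylor's formula in which
the fundamental functions `Φ_n` of the operators `D^{(n+1)}` replace `(v - v₀)^n / n!`. Since `d`
is odd, the `λ_j` form two interlaced arithmetic progressions of step 2, and comparing `q_n'(λ_j)`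
with factorials bounds the terms of `Φ_n(u)` by `(1 + e^u)^n / n!` up to a power of `n`. The
double series is therefore dominated by the geometric series of ratio `σ (e^{v₀} + |z|) < 1`, and
the remainder in Taylor's formula, as `t` runs between `v₀` and `v`, by powers of
`σ (e^t + e^v) < 1`.
-/

namespace Polyharmonic

section Exponents

theorem exponent_two_mul (d k a : ℕ) : exponent d k (2 * a) = k + 2 * a := by
  simp [exponent]

theorem exponent_two_mul_add_one (d k a : ℕ) :
    exponent d k (2 * a + 1) = -k - d + 2 + 2 * a := by
  have h : (2 * a + 1) / 2 = a := by omega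
  simp [exponent, h]

theorem exponent_injective {d : ℕ} (hd : Odd d) (k : ℕ) : Function.Injective (exponent d k) := by
  obtain ⟨c, rfl⟩ := hd
  intro i j h
  obtain ⟨a, rfl | rfl⟩ := Nat.even_or_odd' i <;> obtain ⟨b, rfl | rfl⟩ := Nat.even_or_odd' j <;>
    simp only [exponent_two_mul, exponent_two_mul_add_one] at h <;> omega

end Exponents

section Factorials

open Finset

theorem prod_range_two_mul_add_one (n : ℕ) : ∏ i ∈ range n, 2 * (i + 1) = 2 ^ n * n ! := by
  rw [prod_mul_distrib, prod_const, card_range, prod_range_add_one_eq_factorial]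

theorem two_pow_mul_factorial_le_prod_natAbs {m : ℤ} (hm : Odd m) {s : ℕ} (hs : 1 - 2 * s ≤ m)
    (n : ℕ) : 2 ^ n * n ! ≤ (2 * n + 2) ^ s * ∏ i ∈ range n, (2 * (i + 1 : ℤ) + m).natAbs := by
  induction s generalizing m n with
  | zero =>
    rw [pow_zero, one_mul, ← prod_range_two_mul_add_one]
    exact prod_le_prod' fun i _ => by omega
  | succ s ih =>
    rcases n with _ | n
    · simpa using Nat.one_le_two_pow
    have hshift : ∏ i ∈ range n, (2 * (i + 1 : ℤ) + (m + 2)).natAbs ≤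
        ∏ i ∈ range (n + 1), (2 * (i + 1 : ℤ) + m).natAbs := by
      rw [prod_range_succ']
      refine le_trans (prod_le_prod' fun i _ => ?_) (Nat.le_mul_of_pos_right _ ?_)
      · push_cast; omega
      · obtain ⟨c, rfl⟩ := hm; omega
    calc 2 ^ (n + 1) * (n + 1)! = (2 * n + 2) * (2 ^ n * n !) := by
          rw [Nat.factorial_succ]; ring
      _ ≤ (2 * n + 2) * ((2 * n + 2) ^ s * ∏ i ∈ range n, (2 * (i + 1 : ℤ) + (m + 2)).natAbs) := by
          gcongr 1
          exact ih (hm.add_even even_two) (by push_cast at hs; omega) n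
      _ = (2 * n + 2) ^ (s + 1) * ∏ i ∈ range n, (2 * (i + 1 : ℤ) + (m + 2)).natAbs := by ring
      _ ≤ (2 * (n + 1) + 2) ^ (s + 1) * ∏ i ∈ range (n + 1), (2 * (i + 1 : ℤ) + m).natAbs := by
          gcongr
          omega

theorem two_pow_mul_factorial_mul_le_prod_natAbs {m : ℤ} (hm : Odd m) {s : ℕ}
    (hs : 1 - 2 * s ≤ m) (hs' : 1 - 2 * s ≤ -m - 2) {a M : ℕ} (ha : a ≤ M) :
    (2 ^ a * a !) * (2 ^ (M - a) * (M - a)!) ≤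
      (2 * M + 2) ^ (2 * s) * ∏ b ∈ range M, (2 * ((a : ℤ) - b) + m).natAbs := by
  have hbelow : ∏ b ∈ range a, (2 * ((a : ℤ) - b) + m).natAbs =
      ∏ i ∈ range a, (2 * (i + 1 : ℤ) + m).natAbs := by
    rw [← prod_range_reflect]
    refine prod_congr rfl fun i hi => ?_
    rw [mem_range] at hi
    omega
  have habove : ∏ i ∈ range (M - a), (2 * ((a : ℤ) - (a + i : ℕ)) + m).natAbs =
      ∏ i ∈ range (M - a), (2 * (i + 1 : ℤ) + (-m - 2)).natAbs :=
    prod_congr rfl fun i _ => by omega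
  have hm' : Odd (-m - 2) := hm.neg.sub_even even_two
  calc (2 ^ a * a !) * (2 ^ (M - a) * (M - a)!)
      ≤ ((2 * a + 2) ^ s * ∏ i ∈ range a, (2 * (i + 1 : ℤ) + m).natAbs) *
          ((2 * (M - a) + 2) ^ s * ∏ i ∈ range (M - a), (2 * (i + 1 : ℤ) + (-m - 2)).natAbs) :=
        Nat.mul_le_mul (two_pow_mul_factorial_le_prod_natAbs hm hs a)
          (two_pow_mul_factorial_le_prod_natAbs hm' hs' (M - a))
    _ ≤ ((2 * M + 2) ^ s * ∏ i ∈ range a, (2 * (i + 1 : ℤ) + m).natAbs) *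
          ((2 * M + 2) ^ s * ∏ i ∈ range (M - a), (2 * (i + 1 : ℤ) + (-m - 2)).natAbs) := by
        gcongr
        exact M.sub_le a
    _ = (2 * M + 2) ^ (2 * s) * ∏ b ∈ range M, (2 * ((a : ℤ) - b) + m).natAbs := by
        rw [← habove, ← hbelow, mul_mul_mul_comm, ← prod_range_add, Nat.add_sub_cancel' ha]
        ring

theorem prod_erase_two_mul_sub_natAbs {a N : ℕ} (ha : a ≤ N) :
    ∏ b ∈ (range (N + 1)).erase a, (2 * ((a : ℤ) - b)).natAbs =
      (2 ^ a * a !) * (2 ^ (N - a) * (N - a)!) := by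
  have hsplit : (range (N + 1)).erase a = range a ∪ Ico (a + 1) (N + 1) := by
    ext b; simp only [mem_erase, mem_range, mem_union, mem_Ico]; omega
  have hdisj : Disjoint (range a) (Ico (a + 1) (N + 1)) :=
    disjoint_left.2 fun b hb hb' => by simp only [mem_range, mem_Ico] at hb hb'; omega
  rw [hsplit, prod_union hdisj, prod_Ico_eq_prod_range, ← prod_range_reflect,
    Nat.add_sub_add_right, ← prod_range_two_mul_add_one, ← prod_range_two_mul_add_one]
  congr 1 <;> refine prod_congr rfl fun i hi => ?_ <;> rw [mem_range] at hi <;> omega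

theorem factorial_two_mul_le (N : ℕ) : (2 * N)! ≤ (2 ^ N * N !) ^ 2 := by
  calc (2 * N)! = N.centralBinom * (N ! * N !) := by
        rw [← mul_assoc, Nat.centralBinom_eq_two_mul_choose]
        simpa [two_mul] using (Nat.choose_mul_factorial_mul_factorial (Nat.le_mul_of_pos_left N
          two_pos)).symm
    _ ≤ 2 ^ (2 * N) * (N ! * N !) := Nat.mul_le_mul_right _ (by
        rw [Nat.centralBinom_eq_two_mul_choose]; exact Nat.choose_le_two_pow _ _)
    _ = (2 ^ N * N !) ^ 2 := by ring

theorem pow_mul_factorial_two_mul_le {a N : ℕ} (ha : a ≤ N) {x : ℝ} (hx : 0 ≤ x) :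
    x ^ (2 * a) * (2 * N)! ≤
      (1 + x) ^ (2 * N) * ((2 ^ a * a ! * (2 ^ (N - a) * (N - a)!) : ℕ) : ℝ) ^ 2 := by
  set T := 2 ^ a * a ! * (2 ^ (N - a) * (N - a)!) with hT
  have hbinom : x ^ a * N.choose a ≤ (1 + x) ^ N := by
    rw [add_comm 1 x, add_pow]
    simpa using single_le_sum (f := fun i => x ^ i * 1 ^ (N - i) * (N.choose i : ℝ))
      (fun i _ => by positivity) (mem_range.2 (Nat.lt_succ_of_le ha))
  have hfactor : 2 ^ N * N ! = N.choose a * T := by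
    rw [hT, ← Nat.choose_mul_factorial_mul_factorial ha, ← pow_mul_pow_sub 2 ha]
    ring
  have hfactorial : ((2 * N)! : ℝ) ≤ (N.choose a * T) ^ 2 := by
    exact_mod_cast hfactor ▸ factorial_two_mul_le N
  calc x ^ (2 * a) * (2 * N)! ≤ x ^ (2 * a) * (N.choose a * T) ^ 2 := by gcongr
    _ = (x ^ a * N.choose a) ^ 2 * (T : ℝ) ^ 2 := by ring
    _ ≤ ((1 + x) ^ N) ^ 2 * (T : ℝ) ^ 2 := by gcongr
    _ = (1 + x) ^ (2 * N) * (T : ℝ) ^ 2 := by ring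

theorem factorial_add_two_le (n : ℕ) : (n + 2)! ≤ (n + 4) ^ 2 * n ! := by
  rw [Nat.factorial_succ, Nat.factorial_succ, ← mul_assoc]
  exact Nat.mul_le_mul_right _ (by nlinarith)

end Factorials

section NodalGap

open Finset

theorem prod_erase_two_mul {α : Type*} [CommMonoid α] (f : ℕ → α) (n a : ℕ) :
    ∏ i ∈ (range (n + 1)).erase (2 * a), f i =
      (∏ b ∈ (range (n / 2 + 1)).erase a, f (2 * b)) *
        ∏ b ∈ range ((n + 1) / 2), f (2 * b + 1) := by
  have hsplit : (range (n + 1)).erase (2 * a) =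
      ((range (n / 2 + 1)).erase a).image (2 * ·) ∪ (range ((n + 1) / 2)).image (2 * · + 1) := by
    ext i
    obtain ⟨b, rfl | rfl⟩ := Nat.even_or_odd' i <;> grind
  rw [hsplit, prod_union (disjoint_left.2 (by grind)), prod_image (by grind [Set.InjOn]),
    prod_image (by grind [Set.InjOn])]

theorem prod_erase_two_mul_add_one {α : Type*} [CommMonoid α] (f : ℕ → α) (n a : ℕ) :
    ∏ i ∈ (range (n + 1)).erase (2 * a + 1), f i =
      (∏ b ∈ (range ((n + 1) / 2)).erase a, f (2 * b + 1)) *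
        ∏ b ∈ range (n / 2 + 1), f (2 * b) := by
  have hsplit : (range (n + 1)).erase (2 * a + 1) =
      ((range ((n + 1) / 2)).erase a).image (2 * · + 1) ∪ (range (n / 2 + 1)).image (2 * ·) := by
    ext i
    obtain ⟨b, rfl | rfl⟩ := Nat.even_or_odd' i <;> grind
  rw [hsplit, prod_union (disjoint_left.2 (by grind)), prod_image (by grind [Set.InjOn]),
    prod_image (by grind [Set.InjOn])]

/-- `|q_n'(λ_j)|` for `j ≤ n`, as a natural number so that it can be compared with factorials. -/
def nodalGap (d k n j : ℕ) : ℕ :=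
  ∏ i ∈ (range (n + 1)).erase j, (exponent d k j - exponent d k i).natAbs

theorem nodalGap_pos {d : ℕ} (hd : Odd d) (k n j : ℕ) : 0 < nodalGap d k n j :=
  prod_pos fun _ hi => Int.natAbs_pos.2 <|
    sub_ne_zero.2 <| (exponent_injective hd k).ne (ne_of_mem_erase hi).symm

theorem sq_le_mul_nodalGap_two_mul {d : ℕ} (hd : Odd d) (k : ℕ) {n a : ℕ} (ha : 2 * a ≤ n) :
    (2 ^ a * a ! * (2 ^ (n / 2 - a) * (n / 2 - a)!)) ^ 2 ≤
      (n + 4) ^ (2 * (k + d + 1)) * nodalGap d k n (2 * a) := by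
  have hpos := hd.pos
  have hgap : Odd (2 * (k : ℤ) + d - 2) := by grind
  set M := (n + 1) / 2
  have heven : ∏ b ∈ (range (n / 2 + 1)).erase a,
      (exponent d k (2 * a) - exponent d k (2 * b)).natAbs =
        2 ^ a * a ! * (2 ^ (n / 2 - a) * (n / 2 - a)!) := by
    rw [← prod_erase_two_mul_sub_natAbs (by omega)]
    exact prod_congr rfl fun b _ => by rw [exponent_two_mul, exponent_two_mul]; omega
  have hodd : ∏ b ∈ range M, (exponent d k (2 * a) - exponent d k (2 * b + 1)).natAbs =
      ∏ b ∈ range M, (2 * ((a : ℤ) - b) + (2 * k + d - 2)).natAbs :=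
    prod_congr rfl fun b _ => by rw [exponent_two_mul, exponent_two_mul_add_one]; omega
  have hodd_ge : 2 ^ a * a ! * (2 ^ (n / 2 - a) * (n / 2 - a)!) ≤ (n + 4) ^ (2 * (k + d + 1)) *
      ∏ b ∈ range M, (exponent d k (2 * a) - exponent d k (2 * b + 1)).natAbs := by
    calc 2 ^ a * a ! * (2 ^ (n / 2 - a) * (n / 2 - a)!)
        ≤ 2 ^ a * a ! * (2 ^ (M - a) * (M - a)!) := by gcongr <;> omega
      _ ≤ (2 * M + 2) ^ (2 * (k + d + 1)) *
          ∏ b ∈ range M, (2 * ((a : ℤ) - b) + (2 * k + d - 2)).natAbs :=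
        two_pow_mul_factorial_mul_le_prod_natAbs hgap (by grind) (by grind) (by grind)
      _ ≤ _ := by
        rw [hodd]
        gcongr ?_ ^ _ * _
        omega
  rw [nodalGap, prod_erase_two_mul, heven, sq, mul_left_comm ((n + 4) ^ _)]
  exact Nat.mul_le_mul_left _ hodd_ge

theorem sq_le_mul_nodalGap_two_mul_add_one {d : ℕ} (hd : Odd d) (k : ℕ) {n a : ℕ}
    (ha : 2 * a + 1 ≤ n) :
    (2 ^ a * a ! * (2 ^ ((n - 1) / 2 - a) * ((n - 1) / 2 - a)!)) ^ 2 ≤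
      (n + 4) ^ (2 * (k + d + 1)) * nodalGap d k n (2 * a + 1) := by
  have hpos := hd.pos
  have hgap : Odd (-(2 * (k : ℤ) + d - 2)) := by grind
  set M := n / 2 + 1
  have hodd : ∏ b ∈ (range ((n + 1) / 2)).erase a,
      (exponent d k (2 * a + 1) - exponent d k (2 * b + 1)).natAbs =
        2 ^ a * a ! * (2 ^ ((n - 1) / 2 - a) * ((n - 1) / 2 - a)!) := by
    rw [← prod_erase_two_mul_sub_natAbs (by omega), show (n + 1) / 2 = (n - 1) / 2 + 1 by omega]
    exact prod_congr rfl fun b _ => by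
      rw [exponent_two_mul_add_one, exponent_two_mul_add_one]; omega
  have heven : ∏ b ∈ range M, (exponent d k (2 * a + 1) - exponent d k (2 * b)).natAbs =
      ∏ b ∈ range M, (2 * ((a : ℤ) - b) + -(2 * k + d - 2)).natAbs :=
    prod_congr rfl fun b _ => by rw [exponent_two_mul, exponent_two_mul_add_one]; omega
  have heven_ge : 2 ^ a * a ! * (2 ^ ((n - 1) / 2 - a) * ((n - 1) / 2 - a)!) ≤
      (n + 4) ^ (2 * (k + d + 1)) *
        ∏ b ∈ range M, (exponent d k (2 * a + 1) - exponent d k (2 * b)).natAbs := by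
    calc 2 ^ a * a ! * (2 ^ ((n - 1) / 2 - a) * ((n - 1) / 2 - a)!)
        ≤ 2 ^ a * a ! * (2 ^ (M - a) * (M - a)!) := by gcongr <;> omega
      _ ≤ (2 * M + 2) ^ (2 * (k + d + 1)) *
          ∏ b ∈ range M, (2 * ((a : ℤ) - b) + -(2 * k + d - 2)).natAbs :=
        two_pow_mul_factorial_mul_le_prod_natAbs hgap (by grind) (by grind) (by grind)
      _ ≤ _ := by
        rw [heven]
        gcongr ?_ ^ _ * _
        omega
  rw [nodalGap, prod_erase_two_mul_add_one, hodd, sq, mul_left_comm ((n + 4) ^ _)]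
  exact Nat.mul_le_mul_left _ heven_ge

end NodalGap

section FundamentalFun

open Finset

variable {a : ℕ → ℂ}

/-- The fundamental function `Φ_n` of the operator `(d/dv - a_0) ⋯ (d/dv - a_n)`, that is, the
divided difference of `λ ↦ e^{λ v}` at the nodes `a_0, …, a_n`; it takes the place of `v^n / n!` in
Taylor's formula. -/
noncomputable def fundamentalFun (a : ℕ → ℂ) (n : ℕ) (v : ℝ) : ℂ :=
  ∑ j ∈ range (n + 1), Lagrange.nodalWeight (range (n + 1)) a j * Complex.exp (a j * v)

theorem nodalWeight_range_succ_mul_sub (ha : Function.Injective a) {n j : ℕ} (hj : j < n) :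
    Lagrange.nodalWeight (range (n + 1)) a j * (a j - a n) =
      Lagrange.nodalWeight (range n) a j := by
  have hne : a j - a n ≠ 0 := sub_ne_zero.2 (ha.ne hj.ne)
  rw [Lagrange.nodalWeight, Lagrange.nodalWeight, range_add_one, erase_insert_of_ne hj.ne',
    prod_insert (by simp), mul_right_comm, inv_mul_cancel₀ hne, one_mul]

theorem sum_nodalWeight_eq_zero (ha : Function.Injective a) {n : ℕ} (hn : 2 ≤ n) :
    ∑ j ∈ range n, Lagrange.nodalWeight (range n) a j = 0 := by
  have h := Lagrange.coeff_eq_sum (P := 1) (s := range n) ha.injOn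
    (by rw [Polynomial.degree_one, card_range]; exact_mod_cast by omega)
  rw [card_range, Polynomial.coeff_one, if_neg (by omega)] at h
  simpa [Lagrange.nodalWeight, div_eq_mul_inv] using h.symm

theorem fundamentalFun_zero (a : ℕ → ℂ) (v : ℝ) :
    fundamentalFun a 0 v = Complex.exp (a 0 * v) := by
  simp [fundamentalFun, Lagrange.nodalWeight]

theorem fundamentalFun_succ_apply_zero (ha : Function.Injective a) (n : ℕ) :
    fundamentalFun a (n + 1) 0 = 0 := by
  simpa [fundamentalFun] using sum_nodalWeight_eq_zero ha (n := n + 2) (by omega)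

theorem hasDerivAt_cexp_mul_ofReal (c : ℂ) (v : ℝ) :
    HasDerivAt (fun v : ℝ => Complex.exp (c * v)) (c * Complex.exp (c * v)) v := by
  simpa [mul_comm] using ((hasDerivAt_id v).ofReal_comp.const_mul c).cexp

theorem hasDerivAt_fundamentalFun_zero (a : ℕ → ℂ) (v : ℝ) :
    HasDerivAt (fundamentalFun a 0) (a 0 * fundamentalFun a 0 v) v := by
  rw [funext (fundamentalFun_zero a)]
  exact hasDerivAt_cexp_mul_ofReal (a 0) v

theorem hasDerivAt_fundamentalFun_succ (ha : Function.Injective a) (n : ℕ) (v : ℝ) :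
    HasDerivAt (fundamentalFun a (n + 1))
      (a (n + 1) * fundamentalFun a (n + 1) v + fundamentalFun a n v) v := by
  have h : HasDerivAt (fundamentalFun a (n + 1)) (∑ j ∈ range (n + 2),
      Lagrange.nodalWeight (range (n + 2)) a j * (a j * Complex.exp (a j * v))) v :=
    HasDerivAt.fun_sum fun j _ => (hasDerivAt_cexp_mul_ofReal (a j) v).const_mul _
  refine h.congr_deriv ?_
  rw [fundamentalFun, mul_sum, ← sub_eq_iff_eq_add', ← sum_sub_distrib, sum_range_succ,
    fundamentalFun, mul_left_comm, sub_self, add_zero]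
  refine sum_congr rfl fun j hj => ?_
  rw [← nodalWeight_range_succ_mul_sub ha (mem_range.1 hj)]
  ring

theorem hasDerivAt_sum_mul_fundamentalFun (ha : Function.Injective a) {D : ℕ → ℝ → ℂ} {t : ℝ}
    (hD : ∀ n, HasDerivAt (D n) (D (n + 1) t + a n * D n t) t) (v : ℝ) (N : ℕ) :
    HasDerivAt (fun t => ∑ n ∈ range (N + 1), D n t * fundamentalFun a n (v - t))
      (D (N + 1) t * fundamentalFun a N (v - t)) t := by
  have hs : HasDerivAt (fun t => v - t) (-1) t := (hasDerivAt_id' t).const_sub v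
  induction N with
  | zero =>
    simp only [zero_add, range_one, sum_singleton]
    refine ((hD 0).mul ((hasDerivAt_fundamentalFun_zero a (v - t)).scomp t hs)).congr_deriv ?_
    simp only [neg_smul, one_smul, Function.comp]
    ring
  | succ N ih =>
    simp only [sum_range_succ _ (N + 1)]
    refine (ih.add ((hD (N + 1)).mul
      ((hasDerivAt_fundamentalFun_succ ha N (v - t)).scomp t hs))).congr_deriv ?_
    simp only [neg_smul, one_smul, Function.comp]
    ring

theorem sum_mul_fundamentalFun_sub_self (ha : Function.Injective a) (D : ℕ → ℝ → ℂ) (v : ℝ)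
    (N : ℕ) : ∑ n ∈ range (N + 1), D n v * fundamentalFun a n (v - v) = D 0 v := by
  simp [sum_range_succ', fundamentalFun_succ_apply_zero ha, fundamentalFun_zero]

/-- Taylor's formula for a chain `D_{n+1} = (d/dv - a_n) D_n`. The polynomial at `t`, as a function
of `t`, has a one-term derivative, so its increment is the remainder. -/
theorem norm_sub_sum_mul_fundamentalFun_le (ha : Function.Injective a) {D : ℕ → ℝ → ℂ} {v₀ v : ℝ}
    (hD : ∀ n, ∀ t ∈ Set.uIcc v₀ v, HasDerivAt (D n) (D (n + 1) t + a n * D n t) t) {N : ℕ} {B : ℝ}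
    (hB : ∀ t ∈ Set.uIcc v₀ v, ‖D (N + 1) t * fundamentalFun a N (v - t)‖ ≤ B) :
    ‖D 0 v - ∑ n ∈ range (N + 1), D n v₀ * fundamentalFun a n (v - v₀)‖ ≤ B * ‖v - v₀‖ := by
  rw [← sum_mul_fundamentalFun_sub_self ha D v N]
  exact (convex_uIcc v₀ v).norm_image_sub_le_of_norm_hasDerivWithin_le
    (fun t ht => (hasDerivAt_sum_mul_fundamentalFun ha (fun n => hD n t ht) v N).hasDerivWithinAt)
    hB Set.left_mem_uIcc Set.right_mem_uIcc

end FundamentalFun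

section Estimates

open Finset

variable {d : ℕ} (k : ℕ)

/-- The exponents `λ_j(k)`, as complex interpolation nodes. -/
def node (d k j : ℕ) : ℂ := exponent d k j

theorem node_injective (hd : Odd d) : Function.Injective (node d k) :=
  Int.cast_injective.comp (exponent_injective hd k)

theorem inv_eval_derivative_symbolPoly (d k : ℕ) {n j : ℕ} (hj : j ≤ n) :
    ((Polynomial.derivative (symbolPoly d k n)).eval (exponent d k j : ℂ))⁻¹ =
      Lagrange.nodalWeight (range (n + 1)) (node d k) j :=
  (Lagrange.nodalWeight_eq_eval_derivative_nodal (v := node d k)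
    (mem_range.2 (Nat.lt_succ_of_le hj))).symm

theorem norm_nodalWeight_node (d k n j : ℕ) :
    ‖Lagrange.nodalWeight (range (n + 1)) (node d k) j‖ = (nodalGap d k n j : ℝ)⁻¹ := by
  rw [Lagrange.nodalWeight, norm_prod, nodalGap, Nat.cast_prod, ← prod_inv_distrib]
  refine prod_congr rfl fun i _ => ?_
  rw [node, node, ← Int.cast_sub, norm_inv, Complex.norm_intCast, Nat.cast_natAbs, Int.cast_abs]

theorem norm_cexp_node_mul (d k j : ℕ) (u : ℝ) :
    ‖Complex.exp (node d k j * u)‖ = Real.exp u ^ exponent d k j := by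
  rw [node, Complex.exp_int_mul, norm_zpow, ← Complex.ofReal_exp, Complex.norm_real,
    Real.norm_of_nonneg (Real.exp_pos u).le]

/-- Each of the interlaced progressions `λ_{2a}` and `λ_{2a+1}` contributes a factor
`2^a a! 2^{N-a} (N-a)!` to `q_n'`; the numbers `a`, `N` and `c ∈ {0, 1}` below are those of the
progression containing `λ_j`. -/
theorem zpow_exponent_mul_factorial_le {n j : ℕ} {a N c : ℕ} (haN : a ≤ N) (hNn : 2 * N ≤ n)
    (hnN : n ≤ 2 * N + 2) {s : ℕ}
    (hgap : (2 ^ a * a ! * (2 ^ (N - a) * (N - a)!)) ^ 2 ≤ (n + 4) ^ s * nodalGap d k n j)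
    (hj : exponent d k j = exponent d k c + (2 * a : ℕ)) {x : ℝ} (hx : 0 < x) :
    x ^ exponent d k j * n ! ≤
      (n + 4) ^ (s + 2) * (1 + x) ^ n * x ^ exponent d k c * nodalGap d k n j := by
  have hfactorial : (n ! : ℝ) ≤ (n + 4) ^ 2 * (2 * N)! := by
    exact_mod_cast (Nat.factorial_le hnN).trans <| (factorial_add_two_le (2 * N)).trans <| by gcongr
  have hgap' : ((2 ^ a * a ! * (2 ^ (N - a) * (N - a)!) : ℕ) : ℝ) ^ 2 ≤
      (n + 4) ^ s * nodalGap d k n j := by exact_mod_cast hgap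
  rw [hj, zpow_add₀ hx.ne', zpow_natCast]
  calc x ^ exponent d k c * x ^ (2 * a) * n !
      ≤ x ^ exponent d k c * x ^ (2 * a) * ((n + 4) ^ 2 * (2 * N)!) := by gcongr
    _ = x ^ exponent d k c * (n + 4) ^ 2 * (x ^ (2 * a) * (2 * N)!) := by ring
    _ ≤ x ^ exponent d k c * (n + 4) ^ 2 *
        ((1 + x) ^ n * ((n + 4) ^ s * nodalGap d k n j)) := by
      refine mul_le_mul_of_nonneg_left
        ((pow_mul_factorial_two_mul_le haN hx.le).trans ?_) (by positivity)
      gcongr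
      linarith
    _ = (n + 4) ^ (s + 2) * (1 + x) ^ n * x ^ exponent d k c * nodalGap d k n j := by ring

theorem zpow_exponent_mul_norm_nodalWeight_le (hd : Odd d) {n j : ℕ} (hj : j ≤ n) {x : ℝ}
    (hx : 0 < x) :
    x ^ exponent d k j * ‖Lagrange.nodalWeight (range (n + 1)) (node d k) j‖ ≤
      (n + 4) ^ (2 * (k + d + 2)) * (1 + x) ^ n * (x ^ exponent d k 0 + x ^ exponent d k 1) /
        n ! := by
  have hgap : (0 : ℝ) < nodalGap d k n j := by exact_mod_cast nodalGap_pos hd k n j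
  have h0 : 0 < x ^ exponent d k 0 := zpow_pos hx _
  have h1 : 0 < x ^ exponent d k 1 := zpow_pos hx _
  rw [norm_nodalWeight_node, ← div_eq_mul_inv, div_le_div_iff₀ hgap (by positivity)]
  obtain ⟨a, rfl | rfl⟩ := Nat.even_or_odd' j
  · refine (zpow_exponent_mul_factorial_le k (N := n / 2) (c := 0) (by omega) (by omega) (by omega)
      (sq_le_mul_nodalGap_two_mul hd k hj) (by simp [exponent]) hx).trans ?_
    rw [show 2 * (k + d + 1) + 2 = 2 * (k + d + 2) by ring]
    gcongr
    linarith
  · refine (zpow_exponent_mul_factorial_le k (N := (n - 1) / 2) (c := 1) (by omega) (by omega)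
      (by omega) (sq_le_mul_nodalGap_two_mul_add_one hd k hj)
      (by rw [exponent_two_mul_add_one]; simp [exponent]) hx).trans ?_
    rw [show 2 * (k + d + 1) + 2 = 2 * (k + d + 2) by ring]
    gcongr
    linarith

theorem norm_fundamentalFun_node_le (hd : Odd d) (n : ℕ) (u : ℝ) :
    ‖fundamentalFun (node d k) n u‖ ≤ (n + 4) ^ (2 * (k + d + 2) + 1) * (1 + Real.exp u) ^ n *
      (Real.exp u ^ exponent d k 0 + Real.exp u ^ exponent d k 1) / n ! := by
  set B := (n + 4) ^ (2 * (k + d + 2)) * (1 + Real.exp u) ^ n *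
      (Real.exp u ^ exponent d k 0 + Real.exp u ^ exponent d k 1) / n ! with hB
  calc ‖fundamentalFun (node d k) n u‖ ≤ ∑ _ ∈ range (n + 1), B := by
        refine norm_sum_le_of_le _ fun j hj => ?_
        rw [norm_mul, norm_cexp_node_mul, mul_comm]
        exact zpow_exponent_mul_norm_nodalWeight_le k hd (Nat.lt_succ_iff.1 (mem_range.1 hj))
          (Real.exp_pos u)
    _ = (n + 1) * B := by rw [sum_const, card_range, nsmul_eq_mul]; push_cast; rfl
    _ ≤ (n + 4) * B := by gcongr; norm_num
    _ = _ := by rw [hB]; ring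

end Estimates

section Series

open Finset

variable {d k : ℕ} {g : ℝ → ℂ} {v₀ : ℝ}

theorem sum_seriesTerm_exp (d k : ℕ) (g : ℝ → ℂ) (v₀ v : ℝ) (n : ℕ) :
    ∑ j ∈ range (n + 1), seriesTerm d k g v₀ n j (Real.exp v : ℂ) =
      genDeriv d k n (fun v => g (Real.exp v)) v₀ * fundamentalFun (node d k) n (v - v₀) := by
  rw [fundamentalFun, mul_sum]
  refine sum_congr rfl fun j hj => ?_
  have hexp : Complex.exp (-(exponent d k j : ℂ) * v₀) * Complex.exp (exponent d k j * v) =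
      Complex.exp (node d k j * (v - v₀ : ℝ)) := by
    rw [← Complex.exp_add, node]
    push_cast
    ring_nf
  rw [seriesTerm, div_eq_mul_inv,
    inv_eval_derivative_symbolPoly d k (Nat.lt_succ_iff.1 (mem_range.1 hj)), Complex.ofReal_exp,
    ← Complex.exp_int_mul, ← hexp]
  ring

theorem norm_seriesTerm {n j : ℕ} (hj : j ≤ n) (z : ℂ) :
    ‖seriesTerm d k g v₀ n j z‖ = ‖genDeriv d k n (fun v => g (Real.exp v)) v₀‖ *
      ((‖z‖ / Real.exp v₀) ^ exponent d k j *
        ‖Lagrange.nodalWeight (range (n + 1)) (node d k) j‖) := by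
  have hexp : ‖Complex.exp (-(exponent d k j : ℂ) * v₀)‖ = (Real.exp v₀ ^ exponent d k j)⁻¹ := by
    rw [neg_mul, Complex.exp_neg, norm_inv]
    exact congrArg _ (norm_cexp_node_mul d k j v₀)
  rw [seriesTerm, norm_mul, norm_mul, div_eq_mul_inv, inv_eval_derivative_symbolPoly d k hj,
    norm_mul, norm_zpow, hexp, div_zpow]
  ring

theorem norm_seriesTerm_le (hd : Odd d) {n j : ℕ} (hj : j ≤ n) {z : ℂ} (hz : z ≠ 0) {C σ : ℝ}
    (hC : 0 ≤ C) (hσ : 0 ≤ σ) (hg : ‖genDeriv d k n (fun v => g (Real.exp v)) v₀‖ ≤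
      C * (n + 2)! * (σ * Real.exp v₀) ^ n) :
    ‖seriesTerm d k g v₀ n j z‖ ≤ C * (n + 4) ^ (2 * (k + d + 3)) *
      (σ * (Real.exp v₀ + ‖z‖)) ^ n *
      ((‖z‖ / Real.exp v₀) ^ exponent d k 0 + (‖z‖ / Real.exp v₀) ^ exponent d k 1) := by
  have hρ := Real.exp_pos v₀
  set x := ‖z‖ / Real.exp v₀ with hx_def
  have hx : 0 < x := div_pos (norm_pos_iff.2 hz) hρ
  set A := x ^ exponent d k 0 + x ^ exponent d k 1
  have hfactorial : ((n + 2)! : ℝ) ≤ (n + 4) ^ 2 * n ! := by exact_mod_cast factorial_add_two_le n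
  have hsum : σ * Real.exp v₀ * (1 + x) = σ * (Real.exp v₀ + ‖z‖) := by
    rw [hx_def]; field_simp
  rw [norm_seriesTerm hj]
  calc _ ≤ C * (n + 2)! * (σ * Real.exp v₀) ^ n *
        ((n + 4) ^ (2 * (k + d + 2)) * (1 + x) ^ n * A / n !) := by
        gcongr
        exact zpow_exponent_mul_norm_nodalWeight_le k hd hj hx
    _ ≤ C * ((n + 4) ^ 2 * n !) * (σ * Real.exp v₀) ^ n *
        ((n + 4) ^ (2 * (k + d + 2)) * (1 + x) ^ n * A / n !) := by gcongr
    _ = C * (n + 4) ^ (2 * (k + d + 3)) * (σ * Real.exp v₀ * (1 + x)) ^ n * A := by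
        rw [mul_pow _ (1 + x)]; field_simp; ring
    _ = _ := by rw [hsum]

theorem summable_add_four_pow_mul_geometric (m : ℕ) {θ : ℝ} (h₀ : 0 ≤ θ) (h₁ : θ < 1) :
    Summable fun n : ℕ => (n + 4 : ℝ) ^ m * θ ^ n := by
  have hθ : ‖θ‖ < 1 := by rwa [Real.norm_of_nonneg h₀]
  have hmajor : Summable fun n : ℕ => 2 ^ (m - 1) * ((n : ℝ) ^ m * θ ^ n + 4 ^ m * θ ^ n) :=
    ((summable_pow_mul_geometric_of_norm_lt_one m hθ).add
      ((summable_geometric_of_norm_lt_one hθ).mul_left _)).mul_left _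
  refine hmajor.of_nonneg_of_le (fun n => by positivity) fun n => ?_
  rw [← add_mul, ← mul_assoc]
  gcongr
  exact add_pow_le n.cast_nonneg (by norm_num) m

theorem summable_sigma_fin_geometric (m : ℕ) {θ : ℝ} (h₀ : 0 ≤ θ) (h₁ : θ < 1) :
    Summable fun p : Σ n : ℕ, Fin (n + 1) => (p.1 + 4 : ℝ) ^ m * θ ^ p.1 := by
  refine (summable_sigma_of_nonneg fun p => by positivity).2
    ⟨fun n => (hasSum_fintype _).summable, ?_⟩
  refine (summable_add_four_pow_mul_geometric (m + 1) h₀ h₁).of_nonneg_of_le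
    (fun n => tsum_nonneg fun _ => by positivity) fun n => ?_
  simp only [tsum_fintype, sum_const, card_univ, Fintype.card_fin, nsmul_eq_mul]
  rw [pow_succ', mul_assoc]
  gcongr
  push_cast
  linarith

/-- The sum of the powers of `|z| / e^{v₀}` in `norm_seriesTerm_le` is bounded on `K`, and the rest
is a power of `n` times a geometric sequence. -/
theorem exists_summable_seriesTerm_majorant (hd : Odd d) {C σ : ℝ} (hσ : 0 ≤ σ)
    (hC : 0 ≤ C) (hg : ∀ n, ‖genDeriv d k n (fun v => g (Real.exp v)) v₀‖ ≤
      C * (n + 2)! * (σ * Real.exp v₀) ^ n) {K : Set ℂ} (hK : IsCompact K) (hK0 : ∀ z ∈ K, z ≠ 0)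
    {R : ℝ} (hKR : ∀ z ∈ K, ‖z‖ ≤ R) (hR₀ : 0 ≤ R) (hR : σ * (Real.exp v₀ + R) < 1) :
    ∃ u : (Σ n : ℕ, Fin (n + 1)) → ℝ, Summable u ∧
      ∀ (p : Σ n : ℕ, Fin (n + 1)), ∀ z ∈ K, ‖seriesTerm d k g v₀ p.1 p.2 z‖ ≤ u p := by
  have hcont : ∀ c : ℕ, ContinuousOn (fun z : ℂ => (‖z‖ / Real.exp v₀) ^ exponent d k c) K :=
    fun c => ContinuousOn.zpow₀ (by fun_prop) _ fun z hz =>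
      .inl (div_ne_zero (norm_ne_zero_iff.2 (hK0 z hz)) (Real.exp_pos _).ne')
  obtain ⟨Q, hQ⟩ := hK.exists_bound_of_continuousOn ((hcont 0).add (hcont 1))
  have hu := summable_sigma_fin_geometric (2 * (k + d + 3)) (θ := σ * (Real.exp v₀ + R))
    (by positivity) hR
  refine ⟨_, hu.mul_left (C * |Q|), fun ⟨n, j⟩ z hz => ?_⟩
  refine (norm_seriesTerm_le hd (Nat.lt_succ_iff.1 j.2) (hK0 z hz) hC hσ (hg n)).trans ?_
  rw [mul_assoc C, mul_right_comm C]
  gcongr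
  · exact (le_abs_self _).trans ((hQ z hz).trans (le_abs_self Q))
  · exact hKR z hz

theorem norm_mul_fundamentalFun_le (hd : Odd d) {N : ℕ} {t v : ℝ} {w : ℂ} {C σ : ℝ} (hC : 0 ≤ C)
    (hσ : 0 ≤ σ) (hσt : σ * Real.exp t ≤ 1)
    (hw : ‖w‖ ≤ C * (N + 1)! * (σ * Real.exp t) ^ (N + 1)) :
    ‖w * fundamentalFun (node d k) N (v - t)‖ ≤
      C * (Real.exp (v - t) ^ exponent d k 0 + Real.exp (v - t) ^ exponent d k 1) *
        ((N + 4) ^ (2 * (k + d + 3)) * (σ * (Real.exp t + Real.exp v)) ^ N) := by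
  set A := Real.exp (v - t) ^ exponent d k 0 + Real.exp (v - t) ^ exponent d k 1
  have hsum : σ * Real.exp t * (1 + Real.exp (v - t)) = σ * (Real.exp t + Real.exp v) := by
    rw [Real.exp_sub]; field_simp
  rw [norm_mul]
  calc _ ≤ (C * (N + 1)! * (σ * Real.exp t) ^ (N + 1)) *
        ((N + 4) ^ (2 * (k + d + 2) + 1) * (1 + Real.exp (v - t)) ^ N * A / N !) :=
        mul_le_mul hw (norm_fundamentalFun_node_le k hd N (v - t)) (norm_nonneg _) (by positivity)
    _ = C * A * ((N + 1) * (N + 4) ^ (2 * (k + d + 2) + 1) *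
        (σ * (Real.exp t + Real.exp v)) ^ N) * (σ * Real.exp t) := by
        rw [← hsum, Nat.factorial_succ, pow_succ (σ * Real.exp t), mul_pow (σ * Real.exp t)]
        push_cast
        field_simp
    _ ≤ C * A * ((N + 4) * (N + 4) ^ (2 * (k + d + 2) + 1) *
        (σ * (Real.exp t + Real.exp v)) ^ N) * 1 := by
        gcongr
        norm_num
    _ = _ := by ring

theorem exists_norm_genDeriv_mul_fundamentalFun_le (hd : Odd d) {v : ℝ} {C σ : ℝ} (hσ : 0 ≤ σ)
    (hC : 0 ≤ C) (hg : ∀ p : ℕ, ∀ t ∈ Set.uIcc v₀ v,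
      ‖genDeriv d k (2 * p) g t‖ ≤ C * (2 * p)! * (σ * Real.exp t) ^ (2 * p))
    (hθ : σ * (2 * Real.exp (max v₀ v)) ≤ 1) :
    ∃ A : ℝ, ∀ p : ℕ, ∀ t ∈ Set.uIcc v₀ v,
      ‖genDeriv d k (2 * p + 2) g t * fundamentalFun (node d k) (2 * p + 1) (v - t)‖ ≤
        A * (((2 * p + 1 : ℕ) + 4 : ℝ) ^ (2 * (k + d + 3)) *
          (σ * (2 * Real.exp (max v₀ v))) ^ (2 * p + 1)) := by
  have hcont : ∀ c : ℕ, Continuous fun t : ℝ => Real.exp (v - t) ^ exponent d k c :=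
    fun c => Continuous.zpow₀ (by fun_prop) _ fun t => .inl (Real.exp_pos _).ne'
  obtain ⟨Q, hQ⟩ := (isCompact_uIcc (a := v₀) (b := v)).exists_bound_of_continuousOn
    ((hcont 0).add (hcont 1)).continuousOn
  refine ⟨C * |Q|, fun p t ht => ?_⟩
  have ht_le : Real.exp t ≤ Real.exp (max v₀ v) := Real.exp_le_exp.2 ht.2
  have hv_le : Real.exp v ≤ Real.exp (max v₀ v) := Real.exp_le_exp.2 (le_max_right _ _)
  refine (norm_mul_fundamentalFun_le hd (N := 2 * p + 1) hC hσ (by nlinarith)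
    (hg (p + 1) t ht)).trans ?_
  gcongr
  · exact (le_abs_self _).trans ((hQ t ht).trans (le_abs_self Q))
  · linarith

/-- The remainders of odd index involve only the derivatives of even order, whose growth is known
uniformly on `[v₀, v]`. -/
theorem tendsto_sum_genDeriv_mul_fundamentalFun (hd : Odd d) {v : ℝ}
    (hdiff : ∀ n, ∀ t ∈ Set.uIcc v₀ v, DifferentiableAt ℝ (genDeriv d k n g) t) {C σ : ℝ}
    (hσ : 0 ≤ σ) (hC : 0 ≤ C) (hg : ∀ p : ℕ, ∀ t ∈ Set.uIcc v₀ v,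
      ‖genDeriv d k (2 * p) g t‖ ≤ C * (2 * p)! * (σ * Real.exp t) ^ (2 * p))
    (hθ : σ * (2 * Real.exp (max v₀ v)) < 1) :
    Filter.Tendsto (fun p : ℕ => ∑ n ∈ range (2 * p + 2),
      genDeriv d k n g v₀ * fundamentalFun (node d k) n (v - v₀)) Filter.atTop (nhds (g v)) := by
  obtain ⟨A, hremainder⟩ := exists_norm_genDeriv_mul_fundamentalFun_le hd hσ hC hg hθ.le
  have hchain : ∀ n, ∀ t ∈ Set.uIcc v₀ v, HasDerivAt (genDeriv d k n g)
      (genDeriv d k (n + 1) g t + node d k n * genDeriv d k n g t) t := fun n t ht => by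
    simpa [genDeriv, node] using (hdiff n t ht).hasDerivAt
  have hodd : Filter.Tendsto (fun p : ℕ => 2 * p + 1) Filter.atTop Filter.atTop :=
    Filter.tendsto_atTop_mono (fun p => by rw [id]; omega) Filter.tendsto_id
  have hlim := (((summable_add_four_pow_mul_geometric (2 * (k + d + 3)) (by positivity)
    hθ).tendsto_atTop_zero.comp hodd).const_mul A).mul_const ‖v - v₀‖
  rw [mul_zero, zero_mul] at hlim
  rw [tendsto_iff_norm_sub_tendsto_zero]
  refine squeeze_zero (fun _ => norm_nonneg _) (fun p => ?_) hlim
  rw [norm_sub_rev]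
  exact norm_sub_sum_mul_fundamentalFun_le (node_injective k hd) hchain (hremainder p)

end Series

section LinDeriv

variable {E F : Type*} [NormedAddCommGroup E] [NormedSpace ℝ E] [NormedAddCommGroup F]
  [NormedSpace ℝ F] {h : E → F} {G : Set E} {x : E}

/-- The derivative of `h` along the linear vector field `x ↦ A x`. -/
noncomputable def linDeriv (A : E →L[ℝ] E) (h : E → F) (x : E) : F := fderiv ℝ h x (A x)

theorem contDiffOn_linDeriv (hG : IsOpen G) (hh : ContDiffOn ℝ ∞ h G) (A : E →L[ℝ] E) :
    ContDiffOn ℝ ∞ (linDeriv A h) G :=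
  (hh.fderiv_of_isOpen hG le_rfl).clm_apply A.contDiff.contDiffOn

theorem differentiableAt_fderiv (hh : ContDiffAt ℝ 2 h x) : DifferentiableAt ℝ (fderiv ℝ h) x :=
  (hh.fderiv_right (m := 1) (by norm_num)).differentiableAt one_ne_zero

theorem differentiableAt_linDeriv (hh : ContDiffAt ℝ 2 h x) (A : E →L[ℝ] E) :
    DifferentiableAt ℝ (linDeriv A h) x :=
  (differentiableAt_fderiv hh).clm_apply A.differentiableAt

theorem linDeriv_linDeriv (hh : ContDiffAt ℝ 2 h x) (A : E →L[ℝ] E) :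
    linDeriv A (linDeriv A h) x =
      fderiv ℝ (fderiv ℝ h) x (A x) (A x) + fderiv ℝ h x (A (A x)) := by
  have h' : fderiv ℝ (linDeriv A h) x = _ :=
    ((differentiableAt_fderiv hh).hasFDerivAt.clm_apply A.hasFDerivAt).fderiv
  rw [linDeriv, h']
  simp [add_comm]

theorem linDeriv_mul_sub {f w : E → ℂ} (hf : ContDiffAt ℝ 2 f x) (hw : ContDiffAt ℝ 2 w x)
    (A : E →L[ℝ] E) :
    linDeriv A (fun y => linDeriv A f y * w y - f y * linDeriv A w y) x =
      linDeriv A (linDeriv A f) x * w x - f x * linDeriv A (linDeriv A w) x := by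
  have hderiv := ((differentiableAt_linDeriv hf A).hasFDerivAt.mul
    (hw.differentiableAt two_ne_zero).hasFDerivAt).sub
    ((hf.differentiableAt two_ne_zero).hasFDerivAt.mul (differentiableAt_linDeriv hw A).hasFDerivAt)
  have h' : fderiv ℝ (fun y => linDeriv A f y * w y - f y * linDeriv A w y) x = _ := hderiv.fderiv
  rw [linDeriv, h']
  simp only [linDeriv, _root_.sub_apply, _root_.add_apply, _root_.smul_apply, smul_eq_mul]
  ring

end LinDeriv

section Sphere

open MeasureTheory Metric
open scoped Pointwise

theorem hasDerivAt_integral_of_continuousOn {X F : Type*} [TopologicalSpace X] [CompactSpace X]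
    [SecondCountableTopology X] [MeasurableSpace X] [OpensMeasurableSpace X] [NormedAddCommGroup F]
    [NormedSpace ℝ F] {μ : Measure X} [IsFiniteMeasure μ]
    {f f' : ℝ → X → F} {U : Set ℝ} (hU : IsOpen U) (hf : ∀ t ∈ U, Continuous (f t))
    (hf' : ContinuousOn (Function.uncurry f') (U ×ˢ Set.univ))
    (h : ∀ t ∈ U, ∀ x, HasDerivAt (fun t => f t x) (f' t x) t) {t : ℝ} (ht : t ∈ U) :
    HasDerivAt (fun t => ∫ x, f t x ∂μ) (∫ x, f' t x ∂μ) t := by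
  obtain ⟨ε, hε, hεU⟩ := nhds_basis_closedBall.mem_iff.1 (hU.mem_nhds ht)
  obtain ⟨C, hC⟩ := ((isCompact_closedBall t ε).prod
    (isCompact_univ (X := X))).exists_bound_of_continuousOn (hf'.mono (Set.prod_mono hεU le_rfl))
  have hf't : Continuous (f' t) := by
    rw [← continuousOn_univ]
    exact hf'.comp (f := fun x => (t, x)) (by fun_prop) fun x _ => ⟨ht, trivial⟩
  exact (hasDerivAt_integral_of_dominated_loc_of_deriv_le (bound := fun _ => C)
    (closedBall_mem_nhds t hε)
    (Filter.eventually_of_mem (hU.mem_nhds ht) fun s hs => (hf s hs).aestronglyMeasurable)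
    ((hf t ht).integrable_of_hasCompactSupport (HasCompactSupport.of_compactSpace _))
    hf't.aestronglyMeasurable (.of_forall fun x s hs => hC (s, x) ⟨hs, trivial⟩)
    (integrable_const _) (.of_forall fun x s hs => h s (hεU hs) x)).2

variable {E F : Type*} [NormedAddCommGroup E] [InnerProductSpace ℝ E] [NormedAddCommGroup F]
  [NormedSpace ℝ F]

/-- The action of a linear isometry on the unit sphere. -/
def sphereHomeomorph (e : E ≃ₗᵢ[ℝ] E) : sphere (0 : E) 1 ≃ₜ sphere (0 : E) 1 where
  toFun θ := ⟨e θ, by simp⟩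
  invFun θ := ⟨e.symm θ, by simp⟩
  left_inv θ := by ext; simp
  right_inv θ := by ext; simp
  continuous_toFun := by fun_prop
  continuous_invFun := by fun_prop

theorem Ioo_smul_preimage_sphereHomeomorph (e : E ≃ₗᵢ[ℝ] E) (s : Set (sphere (0 : E) 1)) :
    Set.Ioo (0 : ℝ) 1 • ((↑) '' (sphereHomeomorph e ⁻¹' s) : Set E) =
      e ⁻¹' (Set.Ioo (0 : ℝ) 1 • ((↑) '' s : Set E)) := by
  ext x
  simp only [Set.mem_smul, Set.mem_image, Set.mem_preimage]
  constructor
  · rintro ⟨c, hc, _, ⟨θ, hθ, rfl⟩, rfl⟩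
    exact ⟨c, hc, _, ⟨_, hθ, rfl⟩, (map_smul e c _).symm⟩
  · rintro ⟨c, hc, _, ⟨θ, hθ, rfl⟩, hx⟩
    refine ⟨c, hc, _, ⟨(sphereHomeomorph e).symm θ, by simpa using hθ, rfl⟩, e.injective ?_⟩
    rw [← hx, map_smul]
    exact congrArg (c • ·) (e.apply_symm_apply _)

variable {r : ℝ}

theorem continuous_comp_smul_sphere {X : Type*} [TopologicalSpace X] {h : E → X} {G : Set E}
    (hh : ContinuousOn h G) (hr : ∀ θ : sphere (0 : E) 1, r • (θ : E) ∈ G) :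
    Continuous fun θ : sphere (0 : E) 1 => h (r • (θ : E)) :=
  hh.comp_continuous (by fun_prop) hr

variable [FiniteDimensional ℝ E]

theorem exists_linearIsometryEquiv_exp_smul {A : E →L[ℝ] E}
    (hA : ∀ x y, inner ℝ (A x) y = -inner ℝ x (A y)) (t : ℝ) :
    ∃ e : E ≃ₗᵢ[ℝ] E, ∀ x, e x = NormedSpace.exp (t • A) x := by
  have := FiniteDimensional.complete ℝ E
  let _ : NormedAlgebra ℚ (E →L[ℝ] E) := .restrictScalars ℚ ℝ _
  have hskew : A ∈ skewAdjoint (E →L[ℝ] E) := by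
    rw [skewAdjoint.mem_iff, eq_comm, ContinuousLinearMap.star_eq_adjoint,
      ContinuousLinearMap.eq_adjoint_iff]
    intro x y
    rw [_root_.neg_apply, inner_neg_left, hA, neg_neg]
  exact ⟨Unitary.linearIsometryEquiv
    ⟨_, NormedSpace.exp_mem_unitary_of_mem_skewAdjoint (skewAdjoint.smul_mem t hskew)⟩,
    fun _ => rfl⟩

variable [MeasurableSpace E] [BorelSpace E]

theorem measurePreserving_sphereHomeomorph (e : E ≃ₗᵢ[ℝ] E) :
    MeasurePreserving (sphereHomeomorph e) (volume : Measure E).toSphere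
      (volume : Measure E).toSphere := by
  have hm : Measurable (sphereHomeomorph e) := (sphereHomeomorph e).measurable
  refine ⟨hm, Measure.ext fun s hs => ?_⟩
  rw [Measure.map_apply hm hs, Measure.toSphere_apply' _ (hm hs), Measure.toSphere_apply' _ hs,
    Ioo_smul_preimage_sphereHomeomorph]
  exact congrArg _ (e.measurePreserving.measure_preimage_equiv (f := e.toMeasurableEquiv) _)

theorem integral_comp_sphereHomeomorph (e : E ≃ₗᵢ[ℝ] E) (h : sphere (0 : E) 1 → F) :
    ∫ θ, h (sphereHomeomorph e θ) ∂(volume : Measure E).toSphere =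
      ∫ θ, h θ ∂(volume : Measure E).toSphere :=
  (measurePreserving_sphereHomeomorph e).integral_comp
    (sphereHomeomorph e).measurableEmbedding h

theorem integrable_sphere {h : sphere (0 : E) 1 → ℂ} (hh : Continuous h) :
    Integrable h (volume : Measure E).toSphere :=
  hh.integrable_of_hasCompactSupport (HasCompactSupport.of_compactSpace _)

/-- By invariance of the surface measure, the integral of `h ∘ exp (t A)` does not depend on `t`. -/
theorem integral_linDeriv_eq_zero {G : Set E} (hG : IsOpen G) {h : E → F}
    (hh : ContDiffOn ℝ ∞ h G) (hr : ∀ θ : sphere (0 : E) 1, r • (θ : E) ∈ G) {A : E →L[ℝ] E}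
    (hA : ∀ x y, inner ℝ (A x) y = -inner ℝ x (A y)) :
    ∫ θ : sphere (0 : E) 1, linDeriv A h (r • (θ : E)) ∂(volume : Measure E).toSphere = 0 := by
  have := FiniteDimensional.complete ℝ E
  let _ : NormedAlgebra ℚ (E →L[ℝ] E) := .restrictScalars ℚ ℝ _
  choose R hR using exists_linearIsometryEquiv_exp_smul hA
  have hmem : ∀ t, ∀ θ : sphere (0 : E) 1, r • R t θ ∈ G :=
    fun t θ => hr (sphereHomeomorph (R t) θ)
  have hexp : ∀ t, HasDerivAt (fun t : ℝ => NormedSpace.exp (t • A))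
      (A * NormedSpace.exp (t • A)) t := hasDerivAt_exp_smul_const' (𝕂 := ℝ) A
  have hflow : ∀ (t : ℝ) (x : E), HasDerivAt (fun t => r • R t x) (A (r • R t x)) t := by
    intro t x
    simp only [hR]
    exact (((hexp t).clm_apply (hasDerivAt_const t x)).const_smul r).congr_deriv (by simp)
  have hflow_cont : Continuous fun p : ℝ × sphere (0 : E) 1 => r • R p.1 p.2 := by
    have : Continuous fun t : ℝ => NormedSpace.exp (t • A) := by fun_prop
    simp only [hR]
    fun_prop
  have hderiv := hasDerivAt_integral_of_continuousOn (μ := (volume : Measure E).toSphere)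
    isOpen_univ (f := fun t (θ : sphere (0 : E) 1) => h (r • R t θ))
    (f' := fun t (θ : sphere (0 : E) 1) => linDeriv A h (r • R t θ))
    (fun t _ => (continuous_comp_smul_sphere hh.continuousOn hr).comp
      (sphereHomeomorph (R t)).continuous)
    ((contDiffOn_linDeriv hG hh A).continuousOn.comp hflow_cont.continuousOn
      fun p _ => hmem p.1 p.2)
    (fun t _ θ => ((hh.differentiableOn (by simp)).differentiableAt
      (hG.mem_nhds (hmem t θ))).hasFDerivAt.comp_hasDerivAt t (hflow t θ)) (Set.mem_univ 0)
  have hconst : ∀ t, ∫ θ : sphere (0 : E) 1, h (r • R t θ) ∂(volume : Measure E).toSphere =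
      ∫ θ : sphere (0 : E) 1, h (r • (θ : E)) ∂(volume : Measure E).toSphere :=
    fun t => integral_comp_sphereHomeomorph (R t) fun θ => h (r • (θ : E))
  simp only [hconst] at hderiv
  simpa [hR] using hderiv.unique (hasDerivAt_const (0 : ℝ) _)

theorem integral_linDeriv_linDeriv_mul {G : Set E} (hG : IsOpen G) {f w : E → ℂ}
    (hf : ContDiffOn ℝ ∞ f G) (hw : ContDiff ℝ ∞ w)
    (hr : ∀ θ : sphere (0 : E) 1, r • (θ : E) ∈ G) {A : E →L[ℝ] E}
    (hA : ∀ x y, inner ℝ (A x) y = -inner ℝ x (A y)) :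
    ∫ θ : sphere (0 : E) 1, linDeriv A (linDeriv A f) (r • (θ : E)) * w (r • (θ : E))
        ∂(volume : Measure E).toSphere =
      ∫ θ : sphere (0 : E) 1, f (r • (θ : E)) * linDeriv A (linDeriv A w) (r • (θ : E))
        ∂(volume : Measure E).toSphere := by
  have hwG : ContDiffOn ℝ ∞ w G := hw.contDiffOn
  have hf' := contDiffOn_linDeriv hG hf A
  have hw' := contDiffOn_linDeriv hG hwG A
  have hleft := integrable_sphere (continuous_comp_smul_sphere
    ((contDiffOn_linDeriv hG hf' A).mul hwG).continuousOn hr)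
  have hright := integrable_sphere (continuous_comp_smul_sphere
    (hf.mul (contDiffOn_linDeriv hG hw' A)).continuousOn hr)
  rw [← sub_eq_zero, ← integral_sub hleft hright,
    ← integral_linDeriv_eq_zero hG ((hf'.mul hwG).sub (hf.mul hw')) hr hA]
  refine integral_congr_ae (.of_forall fun θ => ?_)
  exact (linDeriv_mul_sub ((hf.contDiffAt (hG.mem_nhds (hr θ))).of_le (by norm_cast))
    (hw.contDiffAt.of_le (by norm_cast)) A).symm

end Sphere

section Rotations

open MeasureTheory Metric

variable {d : ℕ}

local notation "𝔼" => EuclideanSpace ℝ (Fin d)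

/-- The generator `x ↦ x_i e_j - x_j e_i` of the rotations in a coordinate plane. -/
noncomputable def rotGen (i j : Fin d) : 𝔼 →L[ℝ] 𝔼 :=
  (EuclideanSpace.proj i : 𝔼 →L[ℝ] ℝ).smulRight (EuclideanSpace.single j (1 : ℝ)) -
    (EuclideanSpace.proj j : 𝔼 →L[ℝ] ℝ).smulRight (EuclideanSpace.single i (1 : ℝ))

theorem rotGen_apply (i j : Fin d) (x : 𝔼) : rotGen i j x =
    x i • EuclideanSpace.single j (1 : ℝ) - x j • EuclideanSpace.single i (1 : ℝ) := rfl

theorem inner_rotGen_left (i j : Fin d) (x y : 𝔼) :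
    inner ℝ (rotGen i j x) y = -inner ℝ x (rotGen i j y) := by
  simp only [rotGen_apply, inner_sub_left, inner_sub_right, inner_smul_left, inner_smul_right,
    EuclideanSpace.inner_single_left, EuclideanSpace.inner_single_right, map_one, one_mul,
    conj_trivial]
  ring

theorem sum_smul_single (x : 𝔼) : ∑ i, x i • EuclideanSpace.single i (1 : ℝ) = x := by
  simpa using (EuclideanSpace.basisFun (Fin d) ℝ).sum_repr x

theorem laplacian_apply (f : 𝔼 → ℂ) (x : 𝔼) :
    Δ f x = ∑ i, fderiv ℝ (fderiv ℝ f) x (EuclideanSpace.single i 1)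
      (EuclideanSpace.single i 1) := by
  rw [InnerProductSpace.laplacian_eq_iteratedFDeriv_orthonormalBasis f
    (EuclideanSpace.basisFun (Fin d) ℝ)]
  simp [iteratedFDeriv_two_apply]

theorem contDiffOn_laplacian {f : 𝔼 → ℂ} {G : Set 𝔼} (hG : IsOpen G)
    (hf : ContDiffOn ℝ ∞ f G) : ContDiffOn ℝ ∞ (Δ f) G := by
  have hf'' := (hf.fderiv_of_isOpen hG le_rfl).fderiv_of_isOpen (m := ∞) hG le_rfl
  exact (ContDiffOn.sum fun i _ => (hf''.clm_apply contDiffOn_const).clm_apply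
    contDiffOn_const).congr fun x _ => laplacian_apply f x

theorem sum_bilin_rotGen (B : 𝔼 →L[ℝ] 𝔼 →L[ℝ] ℂ) (x : 𝔼) :
    ∑ i, ∑ j, B (rotGen i j x) (rotGen i j x) =
      2 * ((‖x‖ ^ 2 : ℝ) * ∑ i, B (EuclideanSpace.single i 1) (EuclideanSpace.single i 1) -
        B x x) := by
  set b : Fin d → Fin d → ℂ := fun i j =>
    B (EuclideanSpace.single i 1) (EuclideanSpace.single j 1) with hb
  have hdiag : B x x = ∑ i, ∑ j, (x i : ℂ) * (x j : ℂ) * b i j := by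
    conv_lhs => rw [← sum_smul_single x]
    simp only [map_sum, map_smul, _root_.sum_apply, _root_.smul_apply,
      Finset.smul_sum, Complex.real_smul]
    rw [Finset.sum_comm]
    exact Finset.sum_congr rfl fun i _ => Finset.sum_congr rfl fun j _ => by ring
  have hnorm : ((‖x‖ ^ 2 : ℝ) : ℂ) = ∑ i, (x i : ℂ) ^ 2 := by
    rw [EuclideanSpace.norm_sq_eq]; simp
  have hterm : ∀ i j, B (rotGen i j x) (rotGen i j x) =
      (x i : ℂ) ^ 2 * b j j + (x j : ℂ) ^ 2 * b i i - (x i : ℂ) * x j * b i j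
        - (x j : ℂ) * x i * b j i := by
    intro i j
    simp only [rotGen_apply, map_sub, map_smul, _root_.sub_apply,
      _root_.smul_apply, Complex.real_smul, hb]
    ring
  simp only [hterm, Finset.sum_sub_distrib, Finset.sum_add_distrib]
  rw [hdiag, hnorm, Finset.sum_comm (f := fun i j => (x j : ℂ) ^ 2 * b i i),
    Finset.sum_comm (f := fun i j => (x j : ℂ) * x i * b j i), Finset.sum_mul_sum]
  ring

theorem sum_rotGen_rotGen (x : 𝔼) :
    ∑ i, ∑ j, rotGen i j (rotGen i j x) = (-2 * ((d : ℝ) - 1)) • x := by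
  have hterm : ∀ i j : Fin d, rotGen i j (rotGen i j x) =
      (if i = j then x i • EuclideanSpace.single j (1 : ℝ) else 0) -
        x j • EuclideanSpace.single j (1 : ℝ) - x i • EuclideanSpace.single i (1 : ℝ) +
        (if i = j then x j • EuclideanSpace.single i (1 : ℝ) else 0) := by
    intro i j
    rw [rotGen_apply i j (rotGen i j x), rotGen_apply]
    rcases eq_or_ne i j with rfl | hij
    · simp
    · simp [hij, hij.symm, sub_eq_add_neg, add_comm]
  simp only [hterm, Finset.sum_sub_distrib, Finset.sum_add_distrib, Finset.sum_ite_eq,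
    Finset.mem_univ, if_true, Finset.sum_const, Finset.card_univ, Fintype.card_fin,
    sum_smul_single, ← Finset.smul_sum, ← Nat.cast_smul_eq_nsmul ℝ]
  module

/-- The angular part `∑_{i < j} (x_i ∂_j - x_j ∂_i)²` of `|x|² Δ`, which restricts to the
Laplace-Beltrami operator on spheres. The factor `2⁻¹` allows a sum over all pairs `(i, j)`. -/
noncomputable def angularLaplacian (f : 𝔼 → ℂ) (x : 𝔼) : ℂ :=
  2⁻¹ * ∑ i, ∑ j, linDeriv (rotGen i j) (linDeriv (rotGen i j) f) x

theorem norm_sq_mul_laplacian {f : 𝔼 → ℂ} {x : 𝔼} (hf : ContDiffAt ℝ 2 f x) :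
    (‖x‖ ^ 2 : ℝ) * Δ f x =
      linDeriv (.id ℝ 𝔼) (linDeriv (.id ℝ 𝔼) f) x + (d - 2) * linDeriv (.id ℝ 𝔼) f x +
        angularLaplacian f x := by
  have hfirst : ∑ i, ∑ j, fderiv ℝ f x (rotGen i j (rotGen i j x)) =
      -2 * (d - 1) * fderiv ℝ f x x := by
    simp only [← map_sum]
    rw [sum_rotGen_rotGen, map_smul, Complex.real_smul]
    push_cast; ring
  simp only [angularLaplacian, linDeriv_linDeriv hf, Finset.sum_add_distrib]
  rw [sum_bilin_rotGen, laplacian_apply, hfirst]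
  simp only [linDeriv, ContinuousLinearMap.id_apply]
  ring

theorem contDiffOn_angularLaplacian {f : 𝔼 → ℂ} {G : Set 𝔼} (hG : IsOpen G)
    (hf : ContDiffOn ℝ ∞ f G) : ContDiffOn ℝ ∞ (angularLaplacian f) G :=
  contDiffOn_const.mul <| ContDiffOn.sum fun i _ => ContDiffOn.sum fun j _ =>
    contDiffOn_linDeriv hG (contDiffOn_linDeriv hG hf (rotGen i j)) (rotGen i j)

theorem integral_angularLaplacian_mul {G : Set 𝔼} (hG : IsOpen G) {f w : 𝔼 → ℂ}
    (hf : ContDiffOn ℝ ∞ f G) (hw : ContDiff ℝ ∞ w) {r : ℝ}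
    (hr : ∀ θ : sphere (0 : 𝔼) 1, r • (θ : 𝔼) ∈ G) :
    ∫ θ : sphere (0 : 𝔼) 1, angularLaplacian f (r • (θ : 𝔼)) * w (r • (θ : 𝔼))
        ∂(volume : Measure 𝔼).toSphere =
      ∫ θ : sphere (0 : 𝔼) 1, f (r • (θ : 𝔼)) * angularLaplacian w (r • (θ : 𝔼))
        ∂(volume : Measure 𝔼).toSphere := by
  have hleft : ∀ i j : Fin d, Integrable (fun θ : sphere (0 : 𝔼) 1 =>
      linDeriv (rotGen i j) (linDeriv (rotGen i j) f) (r • (θ : 𝔼)) * w (r • (θ : 𝔼)))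
      (volume : Measure 𝔼).toSphere := fun i j =>
    integrable_sphere <| continuous_comp_smul_sphere ((contDiffOn_linDeriv hG
      (contDiffOn_linDeriv hG hf _) _).mul hw.contDiffOn).continuousOn hr
  have hright : ∀ i j : Fin d, Integrable (fun θ : sphere (0 : 𝔼) 1 =>
      f (r • (θ : 𝔼)) * linDeriv (rotGen i j) (linDeriv (rotGen i j) w) (r • (θ : 𝔼)))
      (volume : Measure 𝔼).toSphere := fun i j =>
    integrable_sphere <| continuous_comp_smul_sphere (hf.mul (contDiffOn_linDeriv hG
      (contDiffOn_linDeriv hG hw.contDiffOn _) _)).continuousOn hr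
  simp only [angularLaplacian, mul_assoc, mul_left_comm _ (2⁻¹ : ℂ), integral_const_mul]
  congr 1
  simp only [Finset.sum_mul, Finset.mul_sum]
  rw [integral_finsetSum _ fun i _ => integrable_finsetSum _ fun j _ => hleft i j,
    integral_finsetSum _ fun i _ => integrable_finsetSum _ fun j _ => hright i j]
  refine Finset.sum_congr rfl fun i _ => ?_
  rw [integral_finsetSum _ fun j _ => hleft i j, integral_finsetSum _ fun j _ => hright i j]
  exact Finset.sum_congr rfl fun j _ =>
    integral_linDeriv_linDeriv_mul hG hf hw hr (inner_rotGen_left i j)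

end Rotations

section Polynomial

open MeasureTheory Metric

variable {d : ℕ}

local notation "𝔼" => EuclideanSpace ℝ (Fin d)

theorem evalReal_C (a : ℂ) : evalReal (MvPolynomial.C a : MvPolynomial (Fin d) ℂ) = fun _ => a :=
  funext fun _ => MvPolynomial.eval_C a

theorem evalReal_add (P Q : MvPolynomial (Fin d) ℂ) :
    evalReal (P + Q) = fun x => evalReal P x + evalReal Q x :=
  funext fun _ => map_add _ P Q

theorem evalReal_mul_X (P : MvPolynomial (Fin d) ℂ) (i : Fin d) :
    evalReal (P * MvPolynomial.X i) = fun x => evalReal P x * ((x i : ℝ) : ℂ) := by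
  ext x; simp [evalReal]

theorem contDiff_evalReal (P : MvPolynomial (Fin d) ℂ) : ContDiff ℝ ∞ (evalReal P) := by
  induction P using MvPolynomial.induction_on with
  | C a => exact evalReal_C a ▸ contDiff_const
  | add p q hp hq => exact evalReal_add p q ▸ hp.add hq
  | mul_X p i hp =>
    exact evalReal_mul_X p i ▸
      hp.mul (Complex.ofRealCLM.comp (EuclideanSpace.proj i : 𝔼 →L[ℝ] ℝ)).contDiff

theorem differentiableAt_evalReal (P : MvPolynomial (Fin d) ℂ) (x : 𝔼) :
    DifferentiableAt ℝ (evalReal P) x :=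
  (contDiff_evalReal P).differentiable (by simp) x

theorem fderiv_evalReal_single (P : MvPolynomial (Fin d) ℂ) (x : 𝔼) (i : Fin d) :
    fderiv ℝ (evalReal P) x (EuclideanSpace.single i 1) =
      evalReal (MvPolynomial.pderiv i P) x := by
  induction P using MvPolynomial.induction_on with
  | C a => rw [evalReal_C]; simp [evalReal]
  | add p q hp hq =>
    rw [evalReal_add,
      fderiv_fun_add (differentiableAt_evalReal p x) (differentiableAt_evalReal q x),
      _root_.add_apply, hp, hq, map_add, evalReal_add]
  | mul_X p j hp =>
    have hcoord : HasFDerivAt (fun x : 𝔼 => ((x j : ℝ) : ℂ))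
        (Complex.ofRealCLM.comp (EuclideanSpace.proj j : 𝔼 →L[ℝ] ℝ)) x :=
      (Complex.ofRealCLM.comp (EuclideanSpace.proj j : 𝔼 →L[ℝ] ℝ)).hasFDerivAt
    have hmul : fderiv ℝ (fun x : 𝔼 => evalReal p x * ((x j : ℝ) : ℂ)) x = _ :=
      ((differentiableAt_evalReal p x).hasFDerivAt.mul hcoord).fderiv
    rw [evalReal_mul_X, hmul]
    simp only [_root_.add_apply, _root_.smul_apply, hp]
    rcases eq_or_ne i j with rfl | hij
    · simp [evalReal]
    · simp [evalReal, MvPolynomial.pderiv_X_of_ne hij.symm, hij.symm, mul_comm]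

theorem laplacian_evalReal (P : MvPolynomial (Fin d) ℂ) (x : 𝔼) :
    Δ (evalReal P) x = evalReal (∑ i, MvPolynomial.pderiv i (MvPolynomial.pderiv i P)) x := by
  rw [laplacian_apply, evalReal, map_sum]
  refine Finset.sum_congr rfl fun i _ => ?_
  have hfderiv : DifferentiableAt ℝ (fderiv ℝ (evalReal P)) x :=
    differentiableAt_fderiv ((contDiff_evalReal P).contDiffAt.of_le (by norm_cast))
  rw [← evalReal, ← fderiv_evalReal_single,
    ← funext fun y => fderiv_evalReal_single P y i,
    (hfderiv.hasFDerivAt.clm_apply (hasFDerivAt_const (EuclideanSpace.single i (1 : ℝ)) x)).fderiv]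
  simp

theorem evalReal_smul {P : MvPolynomial (Fin d) ℂ} {k : ℕ} (hP : P.IsHomogeneous k) (c : ℝ)
    (x : 𝔼) : evalReal P (c • x) = (c : ℂ) ^ k * evalReal P x := by
  rw [evalReal, evalReal, MvPolynomial.eval_eq', MvPolynomial.eval_eq', Finset.mul_sum]
  refine Finset.sum_congr rfl fun m hm => ?_
  have hdegree : ∑ i, m i = k := by
    simpa [Finsupp.weight_apply, Finsupp.sum_fintype] using hP (MvPolynomial.mem_support_iff.1 hm)
  simp only [PiLp.smul_apply, smul_eq_mul, Complex.ofReal_mul, mul_pow, Finset.prod_mul_distrib,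
    Finset.prod_pow_eq_pow_sum, hdegree]
  ring

theorem linDeriv_id_evalReal {P : MvPolynomial (Fin d) ℂ} {k : ℕ} (hP : P.IsHomogeneous k) :
    linDeriv (.id ℝ 𝔼) (evalReal P) = fun x => (k : ℂ) * evalReal P x := by
  ext x
  have hchain : HasDerivAt (fun c : ℝ => evalReal P (c • x)) (fderiv ℝ (evalReal P) x x) 1 := by
    have h := (differentiableAt_evalReal P ((1 : ℝ) • x)).hasFDerivAt.comp_hasDerivAt (1 : ℝ)
      ((hasDerivAt_id (1 : ℝ)).smul_const x)
    simpa only [one_smul, Function.comp_def, id] using h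
  have hpow : HasDerivAt (fun c : ℝ => (c : ℂ) ^ k * evalReal P x) (k * evalReal P x) 1 := by
    simpa using ((hasDerivAt_id (1 : ℝ)).ofReal_comp.pow k).mul_const (evalReal P x)
  simp only [evalReal_smul hP] at hchain
  exact hchain.unique hpow

theorem conj_evalReal (P : MvPolynomial (Fin d) ℂ) (x : 𝔼) :
    (starRingEnd ℂ) (evalReal P x) = evalReal (MvPolynomial.map (starRingEnd ℂ) P) x := by
  rw [evalReal, evalReal, MvPolynomial.eval_map, MvPolynomial.eval, MvPolynomial.coe_eval₂Hom,
    MvPolynomial.hom_eval₂]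
  congr 1
  ext i
  simp

theorem mem_harmonicHomogeneous {k : ℕ} {P : MvPolynomial (Fin d) ℂ} :
    P ∈ harmonicHomogeneous d k ↔ P.IsHomogeneous k ∧
      ∑ i, MvPolynomial.pderiv i (MvPolynomial.pderiv i P) = 0 := by
  simp [harmonicHomogeneous, Submodule.mem_inf, LinearMap.sum_apply]

theorem map_conj_mem_harmonicHomogeneous {k : ℕ} {P : MvPolynomial (Fin d) ℂ}
    (hP : P ∈ harmonicHomogeneous d k) :
    MvPolynomial.map (starRingEnd ℂ) P ∈ harmonicHomogeneous d k := by
  rw [mem_harmonicHomogeneous] at hP ⊢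
  refine ⟨hP.1.map _, ?_⟩
  simp only [MvPolynomial.pderiv_map]
  rw [← map_sum, hP.2, map_zero]

theorem angularLaplacian_evalReal {k : ℕ} {P : MvPolynomial (Fin d) ℂ}
    (hP : P ∈ harmonicHomogeneous d k) (x : 𝔼) :
    angularLaplacian (evalReal P) x = -(k * (k + d - 2)) * evalReal P x := by
  obtain ⟨hhom, hharm⟩ := mem_harmonicHomogeneous.1 hP
  have hradial : linDeriv (.id ℝ 𝔼) (linDeriv (.id ℝ 𝔼) (evalReal P)) x =
      k * (k * evalReal P x) := by
    rw [linDeriv_id_evalReal hhom, linDeriv, fderiv_const_mul (differentiableAt_evalReal P x)]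
    exact congrArg ((k : ℂ) * ·) (congrFun (linDeriv_id_evalReal hhom) x)
  have h := norm_sq_mul_laplacian
    ((contDiff_evalReal P).contDiffAt (x := x) |>.of_le (by norm_cast))
  rw [laplacian_evalReal, hharm, hradial, linDeriv_id_evalReal hhom, evalReal, map_zero,
    mul_zero] at h
  linear_combination -h

end Polynomial

section Radial

open MeasureTheory Metric

variable {d : ℕ} {P : MvPolynomial (Fin d) ℂ}

local notation "𝔼" => EuclideanSpace ℝ (Fin d)

instance instIsFiniteMeasureSurfaceMeasure : IsFiniteMeasure (surfaceMeasure d) :=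
  inferInstanceAs (IsFiniteMeasure (volume : Measure 𝔼).toSphere)

theorem pow_mul_fourierLaplaceCoeff {k : ℕ} (hP : P.IsHomogeneous k) (h : 𝔼 → ℂ) (r : ℝ) :
    (r : ℂ) ^ k * fourierLaplaceCoeff h P r =
      ∫ θ : sphere (0 : 𝔼) 1, h (r • (θ : 𝔼)) *
        evalReal (MvPolynomial.map (starRingEnd ℂ) P) (r • (θ : 𝔼)) ∂(surfaceMeasure d) := by
  rw [fourierLaplaceCoeff, ← integral_const_mul]
  refine integral_congr_ae (.of_forall fun θ => ?_)
  simp only [conj_evalReal, evalReal_smul (hP.map (starRingEnd ℂ))]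
  ring

variable {G : Set (EuclideanSpace ℝ (Fin d))} {f : EuclideanSpace ℝ (Fin d) → ℂ} {r : ℝ}

theorem fourierLaplaceCoeff_angularLaplacian {k : ℕ} (hP : P ∈ harmonicHomogeneous d k)
    (hG : IsOpen G) (hf : ContDiffOn ℝ ∞ f G) (hr₀ : r ≠ 0)
    (hr : ∀ θ : sphere (0 : 𝔼) 1, r • (θ : 𝔼) ∈ G) :
    fourierLaplaceCoeff (angularLaplacian f) P r =
      -(k * (k + d - 2)) * fourierLaplaceCoeff f P r := by
  have hhom := (mem_harmonicHomogeneous.1 hP).1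
  refine mul_left_cancel₀ (pow_ne_zero k (Complex.ofReal_ne_zero.2 hr₀)) ?_
  rw [mul_left_comm, pow_mul_fourierLaplaceCoeff hhom, pow_mul_fourierLaplaceCoeff hhom,
    surfaceMeasure, integral_angularLaplacian_mul hG hf (contDiff_evalReal _) hr,
    ← integral_const_mul]
  refine integral_congr_ae (.of_forall fun θ => ?_)
  simp only [angularLaplacian_evalReal (map_conj_mem_harmonicHomogeneous hP)]
  ring

theorem continuous_mul_conj_evalReal {h : 𝔼 → ℂ} (hh : ContinuousOn h G)
    (hr : ∀ θ : sphere (0 : 𝔼) 1, r • (θ : 𝔼) ∈ G) (P : MvPolynomial (Fin d) ℂ) :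
    Continuous fun θ : sphere (0 : 𝔼) 1 => h (r • (θ : 𝔼)) * (starRingEnd ℂ) (evalReal P θ) :=
  (continuous_comp_smul_sphere hh hr).mul <| Complex.continuous_conj.comp <|
    (contDiff_evalReal P).continuous.comp continuous_subtype_val

theorem sq_mul_fourierLaplaceCoeff_laplacian {k : ℕ} (hP : P ∈ harmonicHomogeneous d k)
    (hG : IsOpen G) (hf : ContDiffOn ℝ ∞ f G) (hr₀ : r ≠ 0)
    (hr : ∀ θ : sphere (0 : 𝔼) 1, r • (θ : 𝔼) ∈ G) :
    (r : ℂ) ^ 2 * fourierLaplaceCoeff (Δ f) P r =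
      fourierLaplaceCoeff (linDeriv (.id ℝ 𝔼) (linDeriv (.id ℝ 𝔼) f)) P r +
      (d - 2) * fourierLaplaceCoeff (linDeriv (.id ℝ 𝔼) f) P r -
      k * (k + d - 2) * fourierLaplaceCoeff f P r := by
  have hint : ∀ {h : 𝔼 → ℂ}, ContDiffOn ℝ ∞ h G → Integrable (fun θ : sphere (0 : 𝔼) 1 =>
      h (r • (θ : 𝔼)) * (starRingEnd ℂ) (evalReal P θ)) (surfaceMeasure d) :=
    fun hh => integrable_sphere (continuous_mul_conj_evalReal hh.continuousOn hr P)
  have hradial := contDiffOn_linDeriv hG hf (.id ℝ 𝔼)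
  have hpointwise : ∀ θ : sphere (0 : 𝔼) 1, (r : ℂ) ^ 2 * Δ f (r • (θ : 𝔼)) =
      linDeriv (.id ℝ 𝔼) (linDeriv (.id ℝ 𝔼) f) (r • (θ : 𝔼)) +
        (d - 2) * linDeriv (.id ℝ 𝔼) f (r • (θ : 𝔼)) + angularLaplacian f (r • (θ : 𝔼)) := by
    intro θ
    rw [← norm_sq_mul_laplacian ((hf.contDiffAt (hG.mem_nhds (hr θ))).of_le (by norm_cast)),
      norm_smul, norm_eq_of_mem_sphere, mul_one, Real.norm_eq_abs, sq_abs, Complex.ofReal_pow]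
  rw [sub_eq_add_neg, ← neg_mul, ← fourierLaplaceCoeff_angularLaplacian hP hG hf hr₀ hr]
  simp only [fourierLaplaceCoeff]
  rw [← integral_const_mul, ← integral_const_mul,
    ← integral_add (hint (contDiffOn_linDeriv hG hradial _)) ((hint hradial).const_mul _),
    ← integral_add ((hint (contDiffOn_linDeriv hG hradial _)).fun_add
      ((hint hradial).const_mul _)) (hint (contDiffOn_angularLaplacian hG hf))]
  refine integral_congr_ae (.of_forall fun θ => ?_)
  simp only [← mul_assoc, hpointwise θ, add_mul]

end Radial

section Annulus

open MeasureTheory Metric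

theorem isOpen_annularRegion (d : ℕ) (r₀ : ℝ≥0) (r₁ : ℝ≥0∞) : IsOpen (annularRegion d r₀ r₁) :=
  (isOpen_lt continuous_const continuous_enorm).inter (isOpen_lt continuous_enorm continuous_const)

/-- The logarithms of the radii occurring in the annular region `A(r₀, r₁)`, that is, the domain of
`f_{k,l}` in the variable `v = log r`. -/
def logRadii (r₀ : ℝ≥0) (r₁ : ℝ≥0∞) : Set ℝ :=
  {v | (r₀ : ℝ) < Real.exp v ∧ ENNReal.ofReal (Real.exp v) < r₁}

theorem isOpen_logRadii (r₀ : ℝ≥0) (r₁ : ℝ≥0∞) : IsOpen (logRadii r₀ r₁) :=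
  (isOpen_lt continuous_const Real.continuous_exp).inter
    (isOpen_lt (ENNReal.continuous_ofReal.comp Real.continuous_exp) continuous_const)

theorem ordConnected_logRadii (r₀ : ℝ≥0) (r₁ : ℝ≥0∞) : (logRadii r₀ r₁).OrdConnected :=
  ⟨fun _ ha _ hb _ ht => ⟨ha.1.trans_le (Real.exp_le_exp.2 ht.1),
    (ENNReal.ofReal_le_ofReal (Real.exp_le_exp.2 ht.2)).trans_lt hb.2⟩⟩

variable {d k : ℕ} {r₀ : ℝ≥0} {r₁ : ℝ≥0∞}

local notation "𝔼" => EuclideanSpace ℝ (Fin d)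

theorem mem_annularRegion_iff_log_norm_mem {x : 𝔼} (hx : 0 < ‖x‖) :
    x ∈ annularRegion d r₀ r₁ ↔ Real.log ‖x‖ ∈ logRadii r₀ r₁ := by
  rw [logRadii, Set.mem_ofPred_eq, Real.exp_log hx, annularRegion, Set.mem_ofPred_eq, ofReal_norm,
    ← ofReal_norm, ← ENNReal.ofReal_coe_nnreal, ENNReal.ofReal_lt_ofReal_iff hx]

theorem norm_exp_smul_sphere (v : ℝ) (θ : sphere (0 : 𝔼) 1) :
    ‖Real.exp v • (θ : 𝔼)‖ = Real.exp v := by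
  rw [norm_smul, norm_eq_of_mem_sphere, mul_one, Real.norm_of_nonneg (Real.exp_pos v).le]

theorem exp_smul_mem_annularRegion {v : ℝ} (hv : v ∈ logRadii r₀ r₁) (θ : sphere (0 : 𝔼) 1) :
    Real.exp v • (θ : 𝔼) ∈ annularRegion d r₀ r₁ := by
  have hnorm := norm_exp_smul_sphere v θ
  have hpos : 0 < ‖Real.exp v • (θ : 𝔼)‖ := by rw [hnorm]; exact Real.exp_pos v
  rwa [mem_annularRegion_iff_log_norm_mem hpos, hnorm, Real.log_exp]

/-- The function `f̃_{k,l}(v) = f_{k,l}(e^v)` of the paper, for `P = Y_{k,l}`. -/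
noncomputable abbrev logCoeff (f : EuclideanSpace ℝ (Fin d) → ℂ) (P : MvPolynomial (Fin d) ℂ)
    (v : ℝ) : ℂ :=
  fourierLaplaceCoeff f P (Real.exp v)

variable {f : EuclideanSpace ℝ (Fin d) → ℂ} {P : MvPolynomial (Fin d) ℂ}

theorem hasDerivAt_logCoeff (hf : ContDiffOn ℝ ∞ f (annularRegion d r₀ r₁))
    (P : MvPolynomial (Fin d) ℂ) {v : ℝ} (hv : v ∈ logRadii r₀ r₁) :
    HasDerivAt (logCoeff f P) (logCoeff (linDeriv (.id ℝ 𝔼) f) P v) v := by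
  have hG := isOpen_annularRegion d r₀ r₁
  have hcont : Continuous fun q : ℝ × sphere (0 : 𝔼) 1 => Real.exp q.1 • (q.2 : 𝔼) := by fun_prop
  have hconj : Continuous fun θ : sphere (0 : 𝔼) 1 => (starRingEnd ℂ) (evalReal P θ) :=
    Complex.continuous_conj.comp ((contDiff_evalReal P).continuous.comp continuous_subtype_val)
  refine hasDerivAt_integral_of_continuousOn (μ := surfaceMeasure d) (isOpen_logRadii r₀ r₁)
    (f' := fun t (θ : sphere (0 : 𝔼) 1) => linDeriv (.id ℝ 𝔼) f (Real.exp t • (θ : 𝔼)) *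
      (starRingEnd ℂ) (evalReal P θ))
    (fun t ht => continuous_mul_conj_evalReal hf.continuousOn (exp_smul_mem_annularRegion ht) P)
    ?_ (fun t ht θ => ?_) hv
  · exact ((contDiffOn_linDeriv hG hf _).continuousOn.comp hcont.continuousOn
      fun q hq => exp_smul_mem_annularRegion hq.1 q.2).mul (hconj.comp continuous_snd).continuousOn
  · have hdiff := (hf.differentiableOn (by simp)).differentiableAt
      (hG.mem_nhds (exp_smul_mem_annularRegion ht θ))
    exact (hdiff.hasFDerivAt.comp_hasDerivAt t
      ((Real.hasDerivAt_exp t).smul_const (θ : 𝔼))).mul_const _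

theorem contDiffOn_iterate_laplacian {G : Set 𝔼} (hG : IsOpen G) (hf : ContDiffOn ℝ ∞ f G)
    (p : ℕ) : ContDiffOn ℝ ∞ (Laplacian.laplacian^[p] f) G := by
  induction p with
  | zero => exact hf
  | succ p ih => exact Function.iterate_succ_apply' _ p f ▸ contDiffOn_laplacian hG ih

theorem exp_two_mul_mul_logCoeff_laplacian (hP : P ∈ harmonicHomogeneous d k)
    (hf : ContDiffOn ℝ ∞ f (annularRegion d r₀ r₁)) {v : ℝ} (hv : v ∈ logRadii r₀ r₁) :
    Complex.exp (2 * v) * logCoeff (Δ f) P v =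
      logCoeff (linDeriv (.id ℝ 𝔼) (linDeriv (.id ℝ 𝔼) f)) P v +
        (d - 2) * logCoeff (linDeriv (.id ℝ 𝔼) f) P v - k * (k + d - 2) * logCoeff f P v := by
  rw [← sq_mul_fourierLaplaceCoeff_laplacian hP (isOpen_annularRegion d r₀ r₁) hf
    (Real.exp_ne_zero v) (exp_smul_mem_annularRegion hv), Complex.ofReal_exp,
    ← Complex.exp_nat_mul, Nat.cast_two]

theorem genDeriv_succ_of_eqOn {n : ℕ} {g w : ℝ → ℂ} {U : Set ℝ} (hU : IsOpen U) {c : ℂ}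
    (hg : Set.EqOn (genDeriv d k n g) (fun v => Complex.exp (c * v) * w v) U) {v : ℝ} (hv : v ∈ U)
    {w' : ℂ} (hw : HasDerivAt w w' v) :
    genDeriv d k (n + 1) g v = Complex.exp (c * v) * (w' + (c - exponent d k n) * w v) := by
  have hderiv := ((hasDerivAt_cexp_mul_ofReal c v).mul hw).congr_of_eventuallyEq
    (Filter.eventually_of_mem (hU.mem_nhds hv) hg)
  have hsucc : genDeriv d k (n + 1) g v =
      deriv (genDeriv d k n g) v - exponent d k n * genDeriv d k n g v := rfl
  rw [hsucc, hderiv.deriv, hg hv]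
  ring

theorem genDeriv_two_mul_add_one_logCoeff_of_eqOn {p : ℕ}
    (hf : ContDiffOn ℝ ∞ f (annularRegion d r₀ r₁))
    (hp : Set.EqOn (genDeriv d k (2 * p) (logCoeff f P))
      (fun v => Complex.exp ((2 * p : ℕ) * v) * logCoeff (Laplacian.laplacian^[p] f) P v)
      (logRadii r₀ r₁)) :
    Set.EqOn (genDeriv d k (2 * p + 1) (logCoeff f P))
      (fun v => Complex.exp ((2 * p : ℕ) * v) *
        (logCoeff (linDeriv (.id ℝ 𝔼) (Laplacian.laplacian^[p] f)) P v -
          k * logCoeff (Laplacian.laplacian^[p] f) P v)) (logRadii r₀ r₁) := by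
  intro v hv
  rw [genDeriv_succ_of_eqOn (isOpen_logRadii r₀ r₁) hp hv (hasDerivAt_logCoeff
    (contDiffOn_iterate_laplacian (isOpen_annularRegion d r₀ r₁) hf p) P hv), exponent_two_mul]
  push_cast
  ring

/-- The identity `D^{(2p)} f̃_{k,l} = e^{2pv} (Δ^p f)~_{k,l}`: on coefficients of degree `k`,
`e^{2v} Δ` acts as `(d/dv - k) (d/dv + k + d - 2)`, and conjugating by `e^{2pv}` shifts the two
exponents by `2p`. -/
theorem genDeriv_two_mul_logCoeff (hP : P ∈ harmonicHomogeneous d k)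
    (hf : ContDiffOn ℝ ∞ f (annularRegion d r₀ r₁)) (p : ℕ) :
    Set.EqOn (genDeriv d k (2 * p) (logCoeff f P))
      (fun v => Complex.exp ((2 * p : ℕ) * v) * logCoeff (Laplacian.laplacian^[p] f) P v)
      (logRadii r₀ r₁) := by
  have hG := isOpen_annularRegion d r₀ r₁
  induction p with
  | zero => intro v _; simp [genDeriv]
  | succ p ih =>
    intro v hv
    have hfp := contDiffOn_iterate_laplacian hG hf p
    have hexp : Complex.exp ((2 * (p + 1) : ℕ) * v) =
        Complex.exp ((2 * p : ℕ) * v) * Complex.exp (2 * v) := by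
      rw [← Complex.exp_add]; push_cast; ring_nf
    rw [mul_add_one, genDeriv_succ_of_eqOn (isOpen_logRadii r₀ r₁)
      (genDeriv_two_mul_add_one_logCoeff_of_eqOn hf ih) hv
      ((hasDerivAt_logCoeff (contDiffOn_linDeriv hG hfp _) P hv).sub
        ((hasDerivAt_logCoeff hfp P hv).const_mul (k : ℂ))), exponent_two_mul_add_one,
      ← mul_add_one]
    beta_reduce
    rw [hexp, Function.iterate_succ_apply', mul_assoc (Complex.exp _),
      exp_two_mul_mul_logCoeff_laplacian hP hfp hv]
    push_cast
    ring

theorem genDeriv_two_mul_add_one_logCoeff (hP : P ∈ harmonicHomogeneous d k)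
    (hf : ContDiffOn ℝ ∞ f (annularRegion d r₀ r₁)) (p : ℕ) :
    Set.EqOn (genDeriv d k (2 * p + 1) (logCoeff f P))
      (fun v => Complex.exp ((2 * p : ℕ) * v) *
        (logCoeff (linDeriv (.id ℝ 𝔼) (Laplacian.laplacian^[p] f)) P v -
          k * logCoeff (Laplacian.laplacian^[p] f) P v)) (logRadii r₀ r₁) :=
  genDeriv_two_mul_add_one_logCoeff_of_eqOn hf (genDeriv_two_mul_logCoeff hP hf p)

theorem differentiableAt_genDeriv_logCoeff (hP : P ∈ harmonicHomogeneous d k)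
    (hf : ContDiffOn ℝ ∞ f (annularRegion d r₀ r₁)) (n : ℕ) {v : ℝ} (hv : v ∈ logRadii r₀ r₁) :
    DifferentiableAt ℝ (genDeriv d k n (logCoeff f P)) v := by
  have hG := isOpen_annularRegion d r₀ r₁
  have hU := (isOpen_logRadii r₀ r₁).mem_nhds hv
  obtain ⟨p, hn⟩ := Nat.even_or_odd' n
  have hfp := contDiffOn_iterate_laplacian hG hf p
  have hexp := (hasDerivAt_cexp_mul_ofReal (2 * p : ℕ) v).differentiableAt
  have hcoeff := (hasDerivAt_logCoeff hfp P hv).differentiableAt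
  have hradial :=
    (hasDerivAt_logCoeff (contDiffOn_linDeriv hG hfp (.id ℝ 𝔼)) P hv).differentiableAt
  rcases hn with rfl | rfl
  · exact (hexp.mul hcoeff).congr_of_eventuallyEq
      (Filter.eventually_of_mem hU (genDeriv_two_mul_logCoeff hP hf p))
  · exact (hexp.mul (hradial.sub (hcoeff.const_mul (k : ℂ)))).congr_of_eventuallyEq
      (Filter.eventually_of_mem hU (genDeriv_two_mul_add_one_logCoeff hP hf p))

theorem isCompact_shell (a b : ℝ) : IsCompact {x : 𝔼 | a ≤ ‖x‖ ∧ ‖x‖ ≤ b} :=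
  (isCompact_closedBall (0 : 𝔼) b).of_isClosed_subset
    ((isClosed_le continuous_const continuous_norm).inter
      (isClosed_le continuous_norm continuous_const))
    fun _ hx => mem_closedBall_zero_iff.2 hx.2

theorem shell_subset_annularRegion {a b : ℝ} (hab : Set.Icc a b ⊆ logRadii r₀ r₁) :
    {x : 𝔼 | Real.exp a ≤ ‖x‖ ∧ ‖x‖ ≤ Real.exp b} ⊆ annularRegion d r₀ r₁ := by
  intro x hx
  have hx0 : 0 < ‖x‖ := (Real.exp_pos a).trans_le hx.1
  exact (mem_annularRegion_iff_log_norm_mem hx0).2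
    (hab ⟨(Real.le_log_iff_exp_le hx0).2 hx.1, (Real.log_le_iff_le_exp hx0).2 hx.2⟩)

theorem norm_logCoeff_le {B v : ℝ} (hf : ∀ θ : sphere (0 : 𝔼) 1, ‖f (Real.exp v • (θ : 𝔼))‖ ≤ B) :
    ‖logCoeff f P v‖ ≤ B * ∫ θ : sphere (0 : 𝔼) 1, ‖evalReal P θ‖ ∂(surfaceMeasure d) := by
  have hint : Integrable (fun θ : sphere (0 : 𝔼) 1 => ‖evalReal P θ‖) (surfaceMeasure d) :=
    (integrable_sphere ((contDiff_evalReal P).continuous.comp continuous_subtype_val)).norm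
  rw [← integral_const_mul]
  refine norm_integral_le_of_norm_le (hint.const_mul _) (.of_forall fun θ => ?_)
  rw [norm_mul, RCLike.norm_conj]
  exact mul_le_mul_of_nonneg_right (hf θ) (norm_nonneg _)

theorem exists_norm_logCoeff_iterate_laplacian_le (P : MvPolynomial (Fin d) ℂ) {τ : ℝ≥0}
    (hf : IsPolyharmonicInfiniteOrder f τ (annularRegion d r₀ r₁)) {a b : ℝ}
    (hab : Set.Icc a b ⊆ logRadii r₀ r₁) {σ : ℝ} (hσ : τ < σ) :
    ∃ C : ℝ, 0 ≤ C ∧ ∀ p : ℕ, ∀ t ∈ Set.Icc a b,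
      ‖logCoeff (Laplacian.laplacian^[p] f) P t‖ ≤ C * (2 * p)! * σ ^ (2 * p) := by
  obtain ⟨C, hC, hbound⟩ := hf.2 _ (shell_subset_annularRegion hab) (isCompact_shell _ _) (σ - τ)
    (sub_pos.2 hσ)
  rw [add_sub_cancel] at hbound
  refine ⟨C * ∫ θ : sphere (0 : 𝔼) 1, ‖evalReal P θ‖ ∂(surfaceMeasure d),
    mul_nonneg hC.le (integral_nonneg fun _ => norm_nonneg _), fun p t ht => ?_⟩
  refine (norm_logCoeff_le fun θ => hbound p _ ?_).trans_eq (by ring)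
  rw [Set.mem_ofPred_eq, norm_exp_smul_sphere]
  exact ⟨Real.exp_le_exp.2 ht.1, Real.exp_le_exp.2 ht.2⟩

end Annulus

section Landau

variable {E : Type*} [NormedAddCommGroup E] [NormedSpace ℝ E] {h w w' : ℝ → E} {a b s : ℝ}

theorem mul_norm_deriv_le_of_norm_deriv_sub_le (hab : a ≤ b)
    (hh : ∀ t ∈ Set.Icc a b, HasDerivAt h (w t) t) {D : ℝ}
    (hD : ∀ t ∈ Set.Icc a b, ‖w t - w s‖ ≤ D) :
    (b - a) * ‖w s‖ ≤ ‖h b‖ + ‖h a‖ + D * (b - a) := by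
  have hderiv : ∀ t ∈ Set.Icc a b,
      HasDerivWithinAt (fun t => h t - t • w s) (w t - w s) (Set.Icc a b) t := fun t ht => by
    simpa using ((hh t ht).fun_sub ((hasDerivAt_id' t).smul_const (w s))).hasDerivWithinAt
  have hmean := (convex_Icc a b).norm_image_sub_le_of_norm_hasDerivWithin_le hderiv hD
    (Set.left_mem_Icc.2 hab) (Set.right_mem_Icc.2 hab)
  rw [Real.norm_of_nonneg (sub_nonneg.2 hab)] at hmean
  calc (b - a) * ‖w s‖ = ‖h b - h a - ((h b - b • w s) - (h a - a • w s))‖ := by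
        rw [← Real.norm_of_nonneg (sub_nonneg.2 hab), ← norm_smul]
        congr 1
        module
    _ ≤ ‖h b‖ + ‖h a‖ + D * (b - a) :=
        (norm_sub_le _ _).trans (add_le_add (norm_sub_le _ _) hmean)

/-- A form of Landau's inequality that tolerates a first-order term in the bound on `h''`. -/
theorem norm_deriv_le_of_norm_deriv_deriv_le (hab : a < b)
    (hh : ∀ t ∈ Set.Icc a b, HasDerivAt h (w t) t)
    (hw : ∀ t ∈ Set.Icc a b, HasDerivAt w (w' t) t) {A B M : ℝ} (hM : 0 ≤ M)
    (hM' : (b - a) * M ≤ 1 / 2) (hA : ∀ t ∈ Set.Icc a b, ‖h t‖ ≤ A)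
    (hB : ∀ t ∈ Set.Icc a b, ‖w' t‖ ≤ B + M * ‖w t‖) (hs : s ∈ Set.Icc a b) :
    ‖w s‖ ≤ 4 * A / (b - a) + 2 * (b - a) * B := by
  have hlen : 0 < b - a := sub_pos.2 hab
  obtain ⟨m, hm, hmax⟩ := isCompact_Icc.exists_isMaxOn ⟨s, hs⟩
    (f := fun t => ‖w t‖) fun t ht => (hw t ht).continuousAt.continuousWithinAt.norm
  refine (hmax hs).trans ?_
  have hw' : ∀ t ∈ Set.Icc a b, ‖w' t‖ ≤ B + M * ‖w m‖ := fun t ht =>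
    (hB t ht).trans (by gcongr; exact hmax ht)
  have hosc : ∀ t ∈ Set.Icc a b, ‖w t - w m‖ ≤ (B + M * ‖w m‖) * (b - a) := fun t ht =>
    ((convex_Icc a b).norm_image_sub_le_of_norm_hasDerivWithin_le
      (fun t ht => (hw t ht).hasDerivWithinAt) hw' hm ht).trans <|
      mul_le_mul_of_nonneg_left (abs_sub_le_of_le_of_le ht.1 ht.2 hm.1 hm.2)
        ((norm_nonneg _).trans (hw' t ht))
  have hmean := mul_norm_deriv_le_of_norm_deriv_sub_le hab.le hh hosc
  have hdiv : 4 * A / (b - a) * (b - a) = 4 * A := div_mul_cancel₀ _ hlen.ne'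
  nlinarith [hA a (Set.left_mem_Icc.2 hab.le), hA b (Set.right_mem_Icc.2 hab.le),
    mul_le_mul_of_nonneg_right hM' (mul_nonneg (norm_nonneg (w m)) hlen.le)]

theorem exists_Icc_subset_and_length_mul_le {U : Set ℝ} (hU : IsOpen U) (hs : s ∈ U) (M : ℝ) :
    ∃ δ > 0, Set.Icc (s - δ) (s + δ) ⊆ U ∧ (s + δ - (s - δ)) * M ≤ 1 / 2 := by
  have hlen : Filter.Tendsto (fun δ : ℝ => (s + δ - (s - δ)) * M) (nhdsWithin 0 (Set.Ioi 0))
      (nhds 0) := by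
    refine ((by fun_prop : Continuous fun δ : ℝ => (s + δ - (s - δ)) * M).tendsto' 0 0 ?_).mono_left
      nhdsWithin_le_nhds
    simp
  obtain ⟨ε, hε, hεU⟩ := Metric.nhds_basis_closedBall.mem_iff.1 (hU.mem_nhds hs)
  obtain ⟨δ, ⟨hδM, hδε⟩, hδ⟩ := ((hlen.eventually_le_const one_half_pos).and
    (Ioc_mem_nhdsGT hε)).and self_mem_nhdsWithin |>.exists
  refine ⟨δ, hδ, ?_, hδM⟩
  rw [← Real.closedBall_eq_Icc]
  exact (Metric.closedBall_subset_closedBall hδε.2).trans hεU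

end Landau

section Growth

variable {d k : ℕ} {r₀ : ℝ≥0} {r₁ : ℝ≥0∞} {f : EuclideanSpace ℝ (Fin d) → ℂ}
  {P : MvPolynomial (Fin d) ℂ}

local notation "𝔼" => EuclideanSpace ℝ (Fin d)

theorem norm_logCoeff_linDeriv_le (hP : P ∈ harmonicHomogeneous d k)
    (hf : ContDiffOn ℝ ∞ f (annularRegion d r₀ r₁)) {a b s A A' : ℝ} (hab : a < b)
    (habU : Set.Icc a b ⊆ logRadii r₀ r₁) (hlen : (b - a) * ‖(d - 2 : ℂ)‖ ≤ 1 / 2)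
    (hA : ∀ t ∈ Set.Icc a b, ‖logCoeff f P t‖ ≤ A)
    (hA' : ∀ t ∈ Set.Icc a b, ‖logCoeff (Δ f) P t‖ ≤ A') (hs : s ∈ Set.Icc a b) :
    ‖logCoeff (linDeriv (.id ℝ 𝔼) f) P s‖ ≤
      4 * A / (b - a) + 2 * (b - a) * (Real.exp (2 * b) * A' + ‖(k * (k + d - 2) : ℂ)‖ * A) := by
  have hradial := contDiffOn_linDeriv (isOpen_annularRegion d r₀ r₁) hf (.id ℝ 𝔼)
  refine norm_deriv_le_of_norm_deriv_deriv_le hab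
    (fun t ht => hasDerivAt_logCoeff hf P (habU ht))
    (fun t ht => hasDerivAt_logCoeff hradial P (habU ht)) (norm_nonneg (d - 2 : ℂ)) hlen hA
    (fun t ht => ?_) hs
  have hode : logCoeff (linDeriv (.id ℝ 𝔼) (linDeriv (.id ℝ 𝔼) f)) P t =
      Complex.exp (2 * t) * logCoeff (Δ f) P t + k * (k + d - 2) * logCoeff f P t -
        (d - 2) * logCoeff (linDeriv (.id ℝ 𝔼) f) P t := by
    rw [exp_two_mul_mul_logCoeff_laplacian hP hf (habU ht)]
    ring
  have hexp : ‖Complex.exp (2 * t)‖ ≤ Real.exp (2 * b) := by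
    rw [Complex.norm_exp]
    simpa using ht.2
  rw [hode]
  refine (norm_sub_le _ _).trans (add_le_add ((norm_add_le _ _).trans (add_le_add ?_ ?_)) ?_)
  · rw [norm_mul]
    exact mul_le_mul hexp (hA' t ht) (norm_nonneg _) (Real.exp_pos _).le
  · rw [norm_mul]
    exact mul_le_mul_of_nonneg_left (hA t ht) (norm_nonneg _)
  · rw [norm_mul]

variable {τ : ℝ≥0} {v₀ σ : ℝ}

theorem exists_norm_logCoeff_linDeriv_le (hP : P ∈ harmonicHomogeneous d k)
    (hf : IsPolyharmonicInfiniteOrder f τ (annularRegion d r₀ r₁)) (hv₀ : v₀ ∈ logRadii r₀ r₁)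
    (hσ : τ < σ) :
    ∃ C : ℝ, ∀ p : ℕ, ‖logCoeff (linDeriv (.id ℝ 𝔼) (Laplacian.laplacian^[p] f)) P v₀‖ ≤
      C * (2 * p + 2)! * σ ^ (2 * p) := by
  obtain ⟨δ, hδ, hU, hlen⟩ :=
    exists_Icc_subset_and_length_mul_le (isOpen_logRadii r₀ r₁) hv₀ ‖(d - 2 : ℂ)‖
  obtain ⟨C, hC, hbound⟩ := exists_norm_logCoeff_iterate_laplacian_le P hf hU hσ
  have hσ0 : 0 < σ := τ.2.trans_lt hσ
  set a := v₀ - δ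
  set b := v₀ + δ
  have hab : a < b := by simp only [a, b]; linarith
  have hv₀I : v₀ ∈ Set.Icc a b := ⟨by simp [a, hδ.le], by simp [b, hδ.le]⟩
  refine ⟨4 * C / (b - a) + 2 * (b - a) * (Real.exp (2 * b) * (C * σ ^ 2) +
    ‖(k * (k + d - 2) : ℂ)‖ * C), fun p => ?_⟩
  have hfact : ((2 * p)! : ℝ) ≤ (2 * p + 2)! := by
    exact_mod_cast Nat.factorial_le (Nat.le_add_right _ 2)
  refine (norm_logCoeff_linDeriv_le hP
    (contDiffOn_iterate_laplacian (isOpen_annularRegion d r₀ r₁) hf.1 p) hab hU hlen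
    (A := C * (2 * p + 2)! * σ ^ (2 * p)) (A' := C * (2 * p + 2)! * σ ^ (2 * p + 2))
    (fun t ht => (hbound p t ht).trans (by gcongr)) (fun t ht => ?_) hv₀I).trans_eq (by ring)
  simpa only [Function.iterate_succ_apply', mul_add_one] using hbound (p + 1) t ht

theorem norm_cexp_natCast_mul_ofReal (n : ℕ) (v : ℝ) :
    ‖Complex.exp (n * v)‖ = Real.exp v ^ n := by
  rw [Complex.exp_nat_mul, norm_pow, Complex.norm_exp_ofReal]

theorem exists_norm_genDeriv_two_mul_logCoeff_le (hP : P ∈ harmonicHomogeneous d k)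
    (hf : IsPolyharmonicInfiniteOrder f τ (annularRegion d r₀ r₁)) {a b : ℝ}
    (hab : Set.Icc a b ⊆ logRadii r₀ r₁) (hσ : τ < σ) :
    ∃ C : ℝ, 0 ≤ C ∧ ∀ p : ℕ, ∀ t ∈ Set.Icc a b,
      ‖genDeriv d k (2 * p) (logCoeff f P) t‖ ≤ C * (2 * p)! * (σ * Real.exp t) ^ (2 * p) := by
  obtain ⟨C, hC, hbound⟩ := exists_norm_logCoeff_iterate_laplacian_le P hf hab hσ
  refine ⟨C, hC, fun p t ht => ?_⟩
  rw [genDeriv_two_mul_logCoeff hP hf.1 p (hab ht), norm_mul, norm_cexp_natCast_mul_ofReal]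
  calc _ ≤ Real.exp t ^ (2 * p) * (C * (2 * p)! * σ ^ (2 * p)) := by
        gcongr; exact hbound p t ht
    _ = _ := by rw [mul_pow]; ring

theorem exists_norm_genDeriv_two_mul_add_one_logCoeff_le (hP : P ∈ harmonicHomogeneous d k)
    (hf : IsPolyharmonicInfiniteOrder f τ (annularRegion d r₀ r₁)) (hv₀ : v₀ ∈ logRadii r₀ r₁)
    (hσ : τ < σ) :
    ∃ C : ℝ, ∀ p : ℕ, ‖genDeriv d k (2 * p + 1) (logCoeff f P) v₀‖ ≤
      C * (2 * p + 2)! * (σ * Real.exp v₀) ^ (2 * p + 1) := by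
  have hσ0 : 0 < σ := τ.2.trans_lt hσ
  obtain ⟨C, hC, hbound⟩ := exists_norm_logCoeff_iterate_laplacian_le P hf
    (a := v₀) (b := v₀) (by simpa using hv₀) hσ
  obtain ⟨C', hbound'⟩ := exists_norm_logCoeff_linDeriv_le hP hf hv₀ hσ
  refine ⟨(C' + k * C) / (σ * Real.exp v₀), fun p => ?_⟩
  have hfact : ((2 * p)! : ℝ) ≤ (2 * p + 2)! := by
    exact_mod_cast Nat.factorial_le (Nat.le_add_right _ 2)
  rw [genDeriv_two_mul_add_one_logCoeff hP hf.1 p hv₀, norm_mul, norm_cexp_natCast_mul_ofReal]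
  calc _ ≤ Real.exp v₀ ^ (2 * p) * (C' * (2 * p + 2)! * σ ^ (2 * p) +
          k * (C * (2 * p + 2)! * σ ^ (2 * p))) := by
        gcongr
        refine (norm_sub_le _ _).trans (add_le_add (hbound' p) ?_)
        rw [norm_mul, Complex.norm_natCast]
        exact mul_le_mul_of_nonneg_left
          ((hbound p v₀ (Set.left_mem_Icc.2 le_rfl)).trans (by gcongr)) k.cast_nonneg
    _ = _ := by
        rw [pow_succ (σ * Real.exp v₀), mul_pow]
        field_simp

theorem exists_norm_genDeriv_logCoeff_le (hP : P ∈ harmonicHomogeneous d k)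
    (hf : IsPolyharmonicInfiniteOrder f τ (annularRegion d r₀ r₁)) (hv₀ : v₀ ∈ logRadii r₀ r₁)
    (hσ : τ < σ) :
    ∃ C : ℝ, 0 ≤ C ∧ ∀ n : ℕ, ‖genDeriv d k n (logCoeff f P) v₀‖ ≤
      C * (n + 2)! * (σ * Real.exp v₀) ^ n := by
  have hσ0 : 0 < σ := τ.2.trans_lt hσ
  obtain ⟨C, hC, heven⟩ := exists_norm_genDeriv_two_mul_logCoeff_le hP hf
    (a := v₀) (b := v₀) (by simpa using hv₀) hσ
  obtain ⟨C', hodd⟩ := exists_norm_genDeriv_two_mul_add_one_logCoeff_le hP hf hv₀ hσ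
  refine ⟨max C C', le_max_of_le_left hC, fun n => ?_⟩
  obtain ⟨p, rfl | rfl⟩ := Nat.even_or_odd' n
  · refine (heven p v₀ (Set.left_mem_Icc.2 le_rfl)).trans ?_
    gcongr
    exacts [le_max_left _ _, Nat.le_add_right _ 2]
  · refine (hodd p).trans ?_
    gcongr
    exacts [le_max_right _ _, Nat.le_succ _]

end Growth

section Expansion

theorem mul_lt_one_of_lt_one_div {τ : ℝ≥0} {x : ℝ}
    (h : ENNReal.ofReal x < 1 / (2 * (τ : ℝ≥0∞))) : 2 * (τ : ℝ) * x < 1 := by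
  rcases eq_or_ne τ 0 with rfl | hτ
  · simp
  have hτ0 : 0 < 2 * (τ : ℝ) := by positivity
  have hdiv : 1 / (2 * (τ : ℝ≥0∞)) = ENNReal.ofReal (1 / (2 * τ)) := by
    rw [ENNReal.ofReal_div_of_pos hτ0, ENNReal.ofReal_mul (by norm_num)]
    simp
  rw [hdiv, ENNReal.ofReal_lt_ofReal_iff (by positivity), lt_div_iff₀ hτ0] at h
  linarith

theorem exists_gt_mul_lt_one {τ x : ℝ} (h : τ * x < 1) : ∃ σ, τ < σ ∧ σ * x < 1 := by
  have hlim : Filter.Tendsto (fun σ : ℝ => σ * x) (nhdsWithin τ (Set.Ioi τ)) (nhds (τ * x)) :=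
    ((continuous_id.mul continuous_const).tendsto τ).mono_left nhdsWithin_le_nhds
  obtain ⟨σ, hσx, hτσ⟩ := ((hlim.eventually_lt_const h).and self_mem_nhdsWithin).exists
  exact ⟨σ, hτσ, hσx⟩

theorem hasSum_sum_range_of_summable_sigma {E : Type*} [NormedAddCommGroup E]
    {t : ℕ → ℕ → E} (ht : Summable fun p : Σ n : ℕ, Fin (n + 1) => t p.1 p.2) :
    HasSum (fun n => ∑ j ∈ Finset.range (n + 1), t n j)
      (∑' p : Σ n : ℕ, Fin (n + 1), t p.1 p.2) :=
  ht.hasSum.sigma fun n => by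
    rw [Finset.sum_range]
    exact hasSum_fintype _

theorem exists_norm_le_of_isCompact_of_enorm_lt {τ : ℝ≥0} {K : Set ℂ} (hK : IsCompact K)
    (hKτ : ∀ z ∈ K, ‖z‖ₑ < 1 / (2 * (τ : ℝ≥0∞))) :
    ∃ R : ℝ, 0 ≤ R ∧ 2 * (τ : ℝ) * R < 1 ∧ ∀ z ∈ K, ‖z‖ ≤ R := by
  rcases K.eq_empty_or_nonempty with rfl | hne
  · exact ⟨0, le_rfl, by simp, by simp⟩
  obtain ⟨z, hz, hmax⟩ := hK.exists_isMaxOn hne continuous_norm.continuousOn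
  refine ⟨‖z‖, norm_nonneg z, mul_lt_one_of_lt_one_div ?_, fun w hw => hmax hw⟩
  rw [ofReal_norm]
  exact hKτ z hz

variable {d k : ℕ} {r₀ : ℝ≥0} {r₁ : ℝ≥0∞} {τ : ℝ≥0} {f : EuclideanSpace ℝ (Fin d) → ℂ}
  {P : MvPolynomial (Fin d) ℂ} {v₀ : ℝ}

theorem exists_summable_seriesTerm_fourierLaplaceCoeff_majorant (hodd : Odd d)
    (hf : IsPolyharmonicInfiniteOrder f τ (annularRegion d r₀ r₁))
    (hP : P ∈ harmonicHomogeneous d k) (hv₀ : v₀ ∈ logRadii r₀ r₁)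
    (hv₀τ : ENNReal.ofReal (Real.exp v₀) < 1 / (2 * (τ : ℝ≥0∞))) {K : Set ℂ} (hK : IsCompact K)
    (hKτ : K ⊆ {z : ℂ | 0 < ‖z‖ₑ ∧ ‖z‖ₑ < 1 / (2 * (τ : ℝ≥0∞))}) :
    ∃ u : (Σ n : ℕ, Fin (n + 1)) → ℝ, Summable u ∧ ∀ p : Σ n : ℕ, Fin (n + 1), ∀ z ∈ K,
      ‖seriesTerm d k (fourierLaplaceCoeff f P) v₀ p.1 p.2 z‖ ≤ u p := by
  obtain ⟨R, hR₀, hRτ, hKR⟩ := exists_norm_le_of_isCompact_of_enorm_lt hK fun z hz => (hKτ hz).2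
  have hρτ := mul_lt_one_of_lt_one_div hv₀τ
  obtain ⟨σ, hτσ, hσR⟩ : ∃ σ, (τ : ℝ) < σ ∧ σ * (Real.exp v₀ + R) < 1 :=
    exists_gt_mul_lt_one (by linarith)
  obtain ⟨C, hC, hbound⟩ := exists_norm_genDeriv_logCoeff_le hP hf hv₀ hτσ
  exact exists_summable_seriesTerm_majorant hodd (τ.2.trans hτσ.le) hC hbound hK
    (fun z hz => enorm_pos.1 (hKτ hz).1) hKR hR₀ hσR

theorem hasSum_sum_seriesTerm_fourierLaplaceCoeff (hodd : Odd d)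
    (hf : IsPolyharmonicInfiniteOrder f τ (annularRegion d r₀ r₁))
    (hP : P ∈ harmonicHomogeneous d k) (hv₀ : v₀ ∈ logRadii r₀ r₁)
    (hv₀τ : ENNReal.ofReal (Real.exp v₀) < 1 / (2 * (τ : ℝ≥0∞))) {z : ℂ} (hz : 0 < ‖z‖ₑ)
    (hzτ : ‖z‖ₑ < 1 / (2 * (τ : ℝ≥0∞))) :
    HasSum (fun n => ∑ j ∈ Finset.range (n + 1),
        seriesTerm d k (fourierLaplaceCoeff f P) v₀ n j z)
      (∑' p : Σ n : ℕ, Fin (n + 1), seriesTerm d k (fourierLaplaceCoeff f P) v₀ p.1 p.2 z) := by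
  obtain ⟨u, hu, hbound⟩ := exists_summable_seriesTerm_fourierLaplaceCoeff_majorant hodd hf hP hv₀
    hv₀τ isCompact_singleton (Set.singleton_subset_iff.2 ⟨hz, hzτ⟩)
  exact hasSum_sum_range_of_summable_sigma
    (Summable.of_norm_bounded hu fun p => hbound p z rfl)

theorem tendsto_sum_genDeriv_logCoeff_mul_fundamentalFun (hodd : Odd d)
    (hf : IsPolyharmonicInfiniteOrder f τ (annularRegion d r₀ r₁))
    (hP : P ∈ harmonicHomogeneous d k) {v : ℝ} (hv₀ : v₀ ∈ logRadii r₀ r₁)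
    (hv₀τ : 2 * τ * Real.exp v₀ < 1) (hv : v ∈ logRadii r₀ r₁) (hvτ : 2 * τ * Real.exp v < 1) :
    Filter.Tendsto (fun p => ∑ n ∈ Finset.range (2 * p + 2),
        genDeriv d k n (logCoeff f P) v₀ * fundamentalFun (node d k) n (v - v₀))
      Filter.atTop (nhds (logCoeff f P v)) := by
  obtain ⟨σ, hτσ, hσv⟩ : ∃ σ, (τ : ℝ) < σ ∧ σ * (2 * Real.exp (max v₀ v)) < 1 :=
    exists_gt_mul_lt_one (by rcases max_choice v₀ v with h | h <;> rw [h] <;> linarith)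
  have hI : Set.uIcc v₀ v ⊆ logRadii r₀ r₁ := (ordConnected_logRadii r₀ r₁).uIcc_subset hv₀ hv
  obtain ⟨C, hC, hbound⟩ := exists_norm_genDeriv_two_mul_logCoeff_le hP hf hI hτσ
  exact tendsto_sum_genDeriv_mul_fundamentalFun hodd
    (fun n t ht => differentiableAt_genDeriv_logCoeff hP hf.1 n (hI ht)) (τ.2.trans hτσ.le) hC
    hbound hσv

theorem seriesSum_fourierLaplaceCoeff_exp (hodd : Odd d)
    (hf : IsPolyharmonicInfiniteOrder f τ (annularRegion d r₀ r₁))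
    (hP : P ∈ harmonicHomogeneous d k) {v : ℝ} (hv₀ : v₀ ∈ logRadii r₀ r₁)
    (hv₀τ : ENNReal.ofReal (Real.exp v₀) < 1 / (2 * (τ : ℝ≥0∞))) (hv : v ∈ logRadii r₀ r₁)
    (hvτ : ENNReal.ofReal (Real.exp v) < 1 / (2 * (τ : ℝ≥0∞))) :
    seriesSum d k (fourierLaplaceCoeff f P) v₀ (Real.exp v : ℂ) =
      fourierLaplaceCoeff f P (Real.exp v) := by
  have hsum := hasSum_sum_seriesTerm_fourierLaplaceCoeff hodd hf hP hv₀ hv₀τ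
    (z := (Real.exp v : ℂ)) (enorm_pos.2 (by exact_mod_cast (Real.exp_pos v).ne'))
    (by rwa [← ofReal_norm, Complex.norm_real, Real.norm_of_nonneg (Real.exp_pos v).le])
  have heven : Filter.Tendsto (fun p => 2 * p + 2) Filter.atTop Filter.atTop :=
    Filter.tendsto_atTop_mono (fun p => by rw [id]; omega) Filter.tendsto_id
  have hpartial := hsum.tendsto_sum_nat.comp heven
  simp only [sum_seriesTerm_exp, Function.comp_def] at hpartial
  rw [seriesSum, hsum.tsum_eq]
  exact tendsto_nhds_unique hpartial (tendsto_sum_genDeriv_logCoeff_mul_fundamentalFun hodd hf hP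
    hv₀ (mul_lt_one_of_lt_one_div hv₀τ) hv (mul_lt_one_of_lt_one_div hvτ))

end Expansion

end Polyharmonic

open Polyharmonic in
theorem mainTheorem6_general {d : ℕ} (hodd : Odd d) {r₀ : ℝ≥0} {r₁ : ℝ≥0∞} {τ : ℝ≥0}
    {f : EuclideanSpace ℝ (Fin d) → ℂ}
    (hf : IsPolyharmonicInfiniteOrder f τ (annularRegion d r₀ r₁))
    {k : ℕ} {P : MvPolynomial (Fin d) ℂ} (hP : P ∈ harmonicHomogeneous d k)
    {v₀ : ℝ} (hv₀ : (r₀ : ℝ) < Real.exp v₀)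
    (hv₀' : ENNReal.ofReal (Real.exp v₀) < min r₁ (1 / (2 * (τ : ℝ≥0∞)))) :
    (∀ K : Set ℂ, IsCompact K → K ⊆ {z : ℂ | 0 < ‖z‖ₑ ∧ ‖z‖ₑ < 1 / (2 * (τ : ℝ≥0∞))} →
      SummableUniformlyOn
        (fun (p : Σ n : ℕ, Fin (n + 1)) (z : ℂ) =>
          ‖seriesTerm d k (fourierLaplaceCoeff f P) v₀ p.1 p.2 z‖) K ∧
      HasSumUniformlyOn
        (fun (p : Σ n : ℕ, Fin (n + 1)) (z : ℂ) =>
          seriesTerm d k (fourierLaplaceCoeff f P) v₀ p.1 p.2 z)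
        (seriesSum d k (fourierLaplaceCoeff f P) v₀) K) ∧
    ∀ r : ℝ, (r₀ : ℝ) < r → ENNReal.ofReal r < min r₁ (1 / (2 * (τ : ℝ≥0∞))) →
      seriesSum d k (fourierLaplaceCoeff f P) v₀ (r : ℂ) = fourierLaplaceCoeff f P r := by
  obtain ⟨hv₀r₁, hv₀τ⟩ := lt_min_iff.1 hv₀'
  refine ⟨fun K hK hKτ => ?_, fun r hr₀ hr => ?_⟩
  · obtain ⟨u, hu, hbound⟩ := exists_summable_seriesTerm_fourierLaplaceCoeff_majorant hodd hf hP
      ⟨hv₀, hv₀r₁⟩ hv₀τ hK hKτ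
    exact ⟨(HasSumUniformlyOn.of_norm_le_summable hu fun p z hz => by
        rw [norm_norm]; exact hbound p z hz).summableUniformlyOn,
      (HasSumUniformlyOn.of_norm_le_summable hu hbound).congr_right fun z hz =>
        (hasSum_sum_seriesTerm_fourierLaplaceCoeff hodd hf hP ⟨hv₀, hv₀r₁⟩ hv₀τ
          (hKτ hz).1 (hKτ hz).2).tsum_eq.symm⟩
  · obtain ⟨hr₁, hrτ⟩ := lt_min_iff.1 hr
    obtain ⟨v, rfl⟩ : ∃ v, Real.exp v = r := ⟨Real.log r, Real.exp_log (r₀.2.trans_lt hr₀)⟩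
    exact seriesSum_fourierLaplaceCoeff_exp hodd hf hP ⟨hv₀, hv₀r₁⟩ hv₀τ ⟨hr₀, hr₁⟩ hrτ

open Polyharmonic in
theorem mainTheorem6 (d : ℕ) (hd : 1 < d) (hodd : Odd d)
    (r₀ : ℝ≥0) (r₁ : ℝ≥0∞) (hr : (r₀ : ℝ≥0∞) < r₁)
    (τ : ℝ≥0) (hτ : (τ : ℝ≥0∞) < 1 / (2 * (r₀ : ℝ≥0∞)))
    (f : EuclideanSpace ℝ (Fin d) → ℂ)
    (hf : IsPolyharmonicInfiniteOrder f τ (annularRegion d r₀ r₁))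
    (k : ℕ) (Y : Fin (harmonicDim d k) → MvPolynomial (Fin d) ℂ)
    (hY : IsOrthonormalHarmonicBasis d k Y) (l : Fin (harmonicDim d k))
    (v₀ : ℝ) (hv₀ : (r₀ : ℝ) < Real.exp v₀)
    (hv₀' : ENNReal.ofReal (Real.exp v₀) < min r₁ (1 / (2 * (τ : ℝ≥0∞)))) :
    (∀ K : Set ℂ, IsCompact K → K ⊆ {z : ℂ | 0 < ‖z‖ₑ ∧ ‖z‖ₑ < 1 / (2 * (τ : ℝ≥0∞))} →
      SummableUniformlyOn
        (fun (p : Σ n : ℕ, Fin (n + 1)) (z : ℂ) =>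
          ‖seriesTerm d k (fourierLaplaceCoeff f (Y l)) v₀ p.1 p.2 z‖) K ∧
      HasSumUniformlyOn
        (fun (p : Σ n : ℕ, Fin (n + 1)) (z : ℂ) =>
          seriesTerm d k (fourierLaplaceCoeff f (Y l)) v₀ p.1 p.2 z)
        (seriesSum d k (fourierLaplaceCoeff f (Y l)) v₀) K) ∧
    ∀ r : ℝ, (r₀ : ℝ) < r → ENNReal.ofReal r < min r₁ (1 / (2 * (τ : ℝ≥0∞))) →
      seriesSum d k (fourierLaplaceCoeff f (Y l)) v₀ (r : ℂ) =
        fourierLaplaceCoeff f (Y l) r :=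
  mainTheorem6_general hodd hf (hY.1 ▸ Submodule.subset_span ⟨l, rfl⟩) hv₀ hv₀'
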